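/- Fix a universal prefix machine $U$ which reads the bits of its program one by one from a one-way input tape and has an auxiliary tape; universal means that every such machine $M$ has a string $r$ such that, for every auxiliary input $y$, $U_y$ does on $rp$ what $M_y$ does on $p$, for all programs $p$. Write $U_y(p)=x$ if $U$ with auxiliary input $y$ outputs $x$ and halts after reading exactly the bits of $p$, and let $\mathbf m(x/y)=\sum_p 2^{-|p|}[U_y(p)=x]$. *Relativized to* $(m,n)$ means that $(m,n)$ is written on the auxiliary tape of $U$ in everything below. An elementary vector or matrix is one whose entries have rational real and imaginary parts; it is identified with its code. The space $\mathcal Q_k$ of $k$ qubits has dimension $2^k$, and a semi-density matrix is a self-adjoint positive semidefinite matrix of trace at most $1$. The universal semi-density matrix over $\mathcal Q_k$ is $$\boldsymbol\mu_k=\sum_{|\phi\rangle}\mathbf m(|\phi\rangle/k)\,|\phi\rangle\langle\phi|,$$ the sum being over the elementary unit vectors $|\phi\rangle\in\mathcal Q_k$. A program $q$ lower computes a matrix $T$ if $U$ on input $q$ reads no more than the bits of $q$ and outputs, with or without halting, a sequence of elementary positive semidefinite matrices $T_0\le T_1\le\dots$ (in the Loewner order) with limit $T$. Put $\underline{\mathbf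 m}(T/k)=\sum\{\mathbf m(q/k): q\text{ lower computes }T\}$. Let $\mathcal C_k$ be the set of all lower computable matrices of the form $A\otimes B$ on $\mathcal Q_k\otimes\mathcal Q_k$ with $\operatorname{Tr}(A\otimes B)(\boldsymbol\mu_k\otimes\boldsymbol\mu_k)\le1$. For semi-density matrices $\sigma,\rho$ over $\mathcal Q_k$, the mutual information is $$\mathbf I(\sigma:\rho)=\log_2\operatorname{Tr}\Big(\sum_{A\otimes B\in\mathcal C_k}\underline{\mathbf m}(A\otimes B/k)\,A\otimes B\Big)(\sigma\otimes\rho),\qquad \log_2 0=-\infty.$$ **Theorem (Conservation of Information, Partial Trace).** There is a constant $c$, depending only on $U$, such that for all natural numbers $m<n$ and all semi-density matrices $\sigma,\rho$ over the space of $n$ qubits $\mathcal Q_n=\mathcal Q_{n-m}\otimes\mathcal Q_m$, relativized to $m$ and $n$, $$\mathbf I(\operatorname{Tr}_{\mathcal Q_m}\sigma:\operatorname{Tr}_{\mathcal Q_m}\rho)\le\mathbf I(\sigma:\rho)+c .$$ -/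

import Mathlib

open scoped ENNReal Matrix Kronecker Topology ComplexOrder

namespace QuantumInfo

/-! ### Machines

A machine has a one-way read-only input tape of bits, an auxiliary input `y` that it can consult
freely, and a one-way output tape on which it prints words.  Words and auxiliary inputs are
identified with natural numbers.  A machine is given by its one-step transitions, which have to be
computable functions of the configuration. -/

/-- A machine.  In a configuration `c` with `halted c = true` it has stopped.  Otherwise it makes
one step: it prints the word `print c`, if there is one, and goes on to `next c (some b)`, where
`b` is the next bit of the input tape, if `reads c = true`, and to `next c none`, leaving the input
tape alone, if `reads c = false`. -/
structure Machine where
  Config : Type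
  [codable : Primcodable Config]
  init : ℕ → Config
  halted : Config → Bool
  reads : Config → Bool
  print : Config → Option ℕ
  next : Config → Option Bool → Config
  computable_init : Computable init
  computable_halted : Computable halted
  computable_reads : Computable reads
  computable_print : Computable print
  computable_next : Computable₂ next

namespace Machine

variable (U : Machine)

/-- The configuration, the part of the input that has not been read, and the list of the words that
have been printed. -/
abbrev State : Type := U.Config × List Bool × List ℕ

/-- One step.  Nothing changes if the machine has halted, or if it asks for a bit after the whole
input has been read. -/
def step (s : U.State) : U.State :=
  if U.halted s.1 then s
  else if U.reads s.1 then
    match s.2.1 with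
    | [] => s
    | b :: rest => (U.next s.1 (some b), rest, s.2.2 ++ (U.print s.1).toList)
  else (U.next s.1 none, s.2.1, s.2.2 ++ (U.print s.1).toList)

/-- The state after `t` steps, with auxiliary input `y` and input `p`. -/
def run (y : ℕ) (p : List Bool) (t : ℕ) : U.State :=
  U.step^[t] (U.init y, p, [])

/-- `U_y(p) = x`: with auxiliary input `y`, the machine outputs `x` and halts, after having read
exactly the bits of `p`. -/
def Returns (y : ℕ) (p : List Bool) (x : ℕ) : Prop :=
  ∃ t, U.halted (U.run y p t).1 = true ∧ (U.run y p t).2.1 = [] ∧ (U.run y p t).2.2 = [x]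

/-- At some time the machine asks for more bits than there are in `p`. -/
def Starves (y : ℕ) (p : List Bool) : Prop :=
  ∃ t, U.halted (U.run y p t).1 = false ∧ U.reads (U.run y p t).1 = true ∧
    (U.run y p t).2.1 = []

/-- On input `p`, the word number `i` (from zero) that the machine prints is `w`. -/
def Prints (y : ℕ) (p : List Bool) (i w : ℕ) : Prop :=
  ∃ t, (U.run y p t).2.2[i]? = some w

/-- `U` is universal: every machine `M` has a helper code `r` such that, for all auxiliary inputs
`y` and all `p`, the machine `U` does on `r ++ p` what `M` does on `p`. -/
def IsUniversal : Prop :=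
  ∀ M : Machine, ∃ r : List Bool, ∀ (y : ℕ) (p : List Bool),
    (∀ x, U.Returns y (r ++ p) x ↔ M.Returns y p x) ∧
    (∀ i w, U.Prints y (r ++ p) i w ↔ M.Prints y p i w) ∧
    (U.Starves y (r ++ p) ↔ M.Starves y p)

/-- The universal probability `m(x / y)`. -/
noncomputable def prob (y x : ℕ) : ℝ≥0∞ :=
  ∑' p : {p : List Bool // U.Returns y p x}, (2⁻¹ : ℝ≥0∞) ^ p.1.length

end Machine

/-! ### Elementary objects and their codes -/

/-- The complex number `a + b i` with rational `a`, `b`. -/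
def toC (z : ℚ × ℚ) : ℂ := ⟨(z.1 : ℝ), (z.2 : ℝ)⟩

def ratCode (a : ℚ) : ℕ × ℕ × ℕ := (a.num.toNat, (-a.num).toNat, a.den)

def gaussCode (z : ℚ × ℚ) : (ℕ × ℕ × ℕ) × (ℕ × ℕ × ℕ) := (ratCode z.1, ratCode z.2)

/-- An elementary pure state of the `d`-dimensional space: a unit vector whose coordinates have
rational real and imaginary parts. -/
def ElementaryState (d : ℕ) : Type :=
  {v : Fin d → ℚ × ℚ // ∑ i, ((v i).1 ^ 2 + (v i).2 ^ 2) = 1}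

namespace ElementaryState

variable {d : ℕ}

def toVec (v : ElementaryState d) : Fin d → ℂ := fun i => toC (v.1 i)

/-- The code of an elementary pure state: that of the list of its coordinates. -/
def code (v : ElementaryState d) : ℕ :=
  Encodable.encode (List.ofFn fun i => gaussCode (v.1 i))

/-- The matrix `|v⟩⟨v|`. -/
noncomputable def proj (v : ElementaryState d) : Matrix (Fin d) (Fin d) ℂ :=
  Matrix.vecMulVec v.toVec (star v.toVec)

end ElementaryState

/-- The complex matrix with the given elementary entries. -/
def toMat {d : ℕ} (E : Fin d → Fin d → ℚ × ℚ) : Matrix (Fin d) (Fin d) ℂ :=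
  Matrix.of fun i j => toC (E i j)

/-- The code of an elementary matrix: that of the list of its rows. -/
def matCode {d : ℕ} (E : Fin d → Fin d → ℚ × ℚ) : ℕ :=
  Encodable.encode (List.ofFn fun i => List.ofFn fun j => gaussCode (E i j))

/-! ### Lower computable matrices -/

/-- `q` lower computes `M` (relative to the auxiliary input `x`): on input `q` the machine reads at
most the bits of `q` and prints, with or without halting, the codes of a sequence `E 0`, `E 1`, …
of elementary positive semidefinite matrices that increases to `M`.  If the printed sequence is
finite, then it is prolonged by its last term. -/
def Machine.LowerComputes (U : Machine) (x : ℕ) (q : List Bool) {d : ℕ}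
    (M : Matrix (Fin d) (Fin d) ℂ) : Prop :=
  ¬ U.Starves x q ∧
  ∃ E : ℕ → Fin d → Fin d → ℚ × ℚ,
    (∃ w, U.Prints x q 0 w) ∧
    (∀ i w, U.Prints x q i w → w = matCode (E i)) ∧
    (∀ i, (∀ w, ¬ U.Prints x q (i + 1) w) → E (i + 1) = E i) ∧
    (∀ i, (toMat (E i)).PosSemidef) ∧
    (∀ i, (toMat (E (i + 1)) - toMat (E i)).PosSemidef) ∧
    Filter.Tendsto (fun i => toMat (E i)) Filter.atTop (𝓝 M)

/-! ### Universal matrix, tests and information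

Everything is relativized to `x`: the machine has `x` on its auxiliary tape, beside the number `k`
of qubits where a quantity is conditional on that number.  The space of `k` qubits has the basis
`Fin (2 ^ k)`. -/

/-- The lower algorithmic probability of `M` given the number `k`. -/
noncomputable def lowerProb (U : Machine) (x k : ℕ) {d : ℕ} (M : Matrix (Fin d) (Fin d) ℂ) :
    ℝ≥0∞ :=
  ∑' q : {q : List Bool // U.LowerComputes x q M}, U.prob (Nat.pair k x) (Encodable.encode q.1)

/-- The universal semi-density matrix over `k` qubits. -/
noncomputable def universalMatrix (U : Machine) (x k : ℕ) : Matrix (Fin (2 ^ k)) (Fin (2 ^ k)) ℂ :=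
  ∑' v : ElementaryState (2 ^ k), (U.prob (Nat.pair k x) v.code).toReal • v.proj

/-- The tensor product of two matrices, on the space of dimension `d * d`. -/
def tensor {d : ℕ} (A B : Matrix (Fin d) (Fin d) ℂ) : Matrix (Fin (d * d)) (Fin (d * d)) ℂ :=
  Matrix.reindex finProdFinEquiv finProdFinEquiv (A ⊗ₖ B)

/-- The lower computable product matrices `A ⊗ B` with `Tr (A ⊗ B)(C ⊗ D) ≤ 1`. -/
def productTests (U : Machine) (x : ℕ) {d : ℕ} (C D : Matrix (Fin d) (Fin d) ℂ) :
    Set (Matrix (Fin (d * d)) (Fin (d * d)) ℂ) :=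
  {T | (∃ q, U.LowerComputes x q T) ∧ (∃ A B, T = tensor A B) ∧
    (Matrix.trace (T * tensor C D)).re ≤ 1}

/-- The sum of the product tests for `μ ⊗ μ`, weighted by lower algorithmic probability. -/
noncomputable def infoMatrix (U : Machine) (x k : ℕ) :
    Matrix (Fin (2 ^ k * 2 ^ k)) (Fin (2 ^ k * 2 ^ k)) ℂ :=
  ∑' T : productTests U x (universalMatrix U x k) (universalMatrix U x k), (lowerProb U x k T.1).toReal • T.1

/-- The binary logarithm of a nonnegative number, with `log 0 = -∞`. -/
noncomputable def log2 (r : ℝ) : EReal :=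
  if 0 < r then ((Real.logb 2 r : ℝ) : EReal) else ⊥

/-- The mutual information `I(σ : ρ)` of two semi-density matrices over `k` qubits. -/
noncomputable def info (U : Machine) (x k : ℕ) (σ ρ : Matrix (Fin (2 ^ k)) (Fin (2 ^ k)) ℂ) :
    EReal :=
  log2 (Matrix.trace (infoMatrix U x k * tensor σ ρ)).re

/-- Semi-density matrices. -/
def IsSemiDensity {d : ℕ} (σ : Matrix (Fin d) (Fin d) ℂ) : Prop :=
  σ.PosSemidef ∧ σ.trace.re ≤ 1

/-- The basis vector `|i⟩|z⟩` of the space of `n` qubits, for basis vectors `|i⟩` of the first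
`n - m` qubits and `|z⟩` of the last `m` qubits. -/
def joinIndex {m n : ℕ} (h : m ≤ n) (i : Fin (2 ^ (n - m))) (z : Fin (2 ^ m)) : Fin (2 ^ n) :=
  Fin.cast (by rw [← pow_add, Nat.sub_add_cancel h]) (finProdFinEquiv (i, z))

/-- The partial trace over the last `m` qubits. -/
def partialTrace {m n : ℕ} (h : m ≤ n) (σ : Matrix (Fin (2 ^ n)) (Fin (2 ^ n)) ℂ) :
    Matrix (Fin (2 ^ (n - m))) (Fin (2 ^ (n - m))) ℂ :=
  Matrix.of fun i j => ∑ z : Fin (2 ^ m), σ (joinIndex h i z) (joinIndex h j z)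

end QuantumInfo

/-! Extending a test `T = A ⊗ B` for two systems of n - m qubits by the identity gives a matrix on
two systems of n qubits. Extension is adjoint to the partial trace (`trace_extendMatrix_mul`): the
extension has on σ ⊗ ρ the trace that `T` has on Tr σ ⊗ Tr ρ. It is again a product, and it is lower
computed, up to a constant divisor, by the program of `T` behind a fixed prefix, so its weight falls
by at most a constant factor (`lowerProb_extendMatrix`). If the extension is a test again up to a
constant, the sum defining the information of the partial traces embeds term by term into the sum
for σ and ρ, and the theorem follows.

By adjointness, applied to μ_n ⊗ μ_n, the test condition reduces to the domination Tr μ_n ≤ 2^N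
μ_{n-m} with N independent of m and n (`partialTrace_universalMatrix_le`). This is the core of the
proof. The partial trace of |ψ⟩⟨ψ| is the sum of |ψ_z⟩⟨ψ_z| over the blocks ψ_z of ψ, which suggests
a random process: produce ψ with probability m(ψ), choose z with probability |ψ_z|², output the
normalized block. Universality bounds the distribution of the output by a multiple of m.

The obstacle is that |ψ_z| may be irrational, so that the normalized block is not elementary. But
ψ_z = s a - P e₀ with rational s, P whose squares are at most 16 |ψ_z|², where e₀ is a basis vector
and a is elementary (if s = 0, the first term is absent). Hence |⟨u, ψ_z⟩|² is at most 32 |ψ_z|²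
times the sum of the overlaps of u with a and e₀ (`overlap_le`), and both states are put on the list
from which the machine samples (`sum_overlap_le`, `prob_sample_le`). Since a Loewner inequality can
be tested on vectors u, only averages of overlaps have to be compared, never the probabilities of
single outputs.

Sums are compared in `ℝ≥0∞`, where an injection between index sets is all that is needed;
`ofReal_functional_tsum` translates matrix sums into such sums. -/

namespace QuantumInfo

namespace Machine

attribute [instance] Machine.codable

variable (U : Machine)

/-! ### Runs -/

theorem run_succ (y : ℕ) (p : List Bool) (t : ℕ) : U.run y p (t + 1) = U.step (U.run y p t) :=
  Function.iterate_succ_apply' _ _ _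

variable {U}

theorem step_of_halted {s : U.State} (h : U.halted s.1 = true) : U.step s = s := by
  simp [step, h]

/-- A state in which the machine asks for a bit that is not there. -/
def Starved (s : U.State) : Prop :=
  U.halted s.1 = false ∧ U.reads s.1 = true ∧ s.2.1 = []

theorem step_of_starved {s : U.State} (h : Starved s) : U.step s = s := by
  obtain ⟨c, l, o⟩ := s
  obtain ⟨h1, h2, h3⟩ := h
  simp only at h1 h2 h3
  subst h3
  simp [step, h1, h2]

theorem iterate_step_of_eq {s : U.State} (h : U.step s = s) (t : ℕ) : U.step^[t] s = s :=
  Function.iterate_fixed h t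

theorem run_eq_of_le {y : ℕ} {p : List Bool} {t t' : ℕ} (h : U.step (U.run y p t) = U.run y p t)
    (htt : t ≤ t') : U.run y p t' = U.run y p t := by
  obtain ⟨d, rfl⟩ := Nat.exists_eq_add_of_le' htt
  have : U.run y p (d + t) = U.step^[d] (U.run y p t) := Function.iterate_add_apply _ _ _ _
  rw [this, iterate_step_of_eq h]

theorem Returns.exists_first {y : ℕ} {p : List Bool} {x : ℕ} (h : U.Returns y p x) :
    ∃ t, U.halted (U.run y p t).1 = true ∧ (U.run y p t).2.1 = [] ∧ (U.run y p t).2.2 = [x] ∧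
      ∀ s < t, U.halted (U.run y p s).1 = false ∧ ¬ Starved (U.run y p s) := by
  classical
  obtain ⟨t', ht', hr, ho⟩ := h
  have hex : ∃ t, U.halted (U.run y p t).1 = true := ⟨t', ht'⟩
  have hle : Nat.find hex ≤ t' := Nat.find_min' hex ht'
  have heq : U.run y p t' = U.run y p (Nat.find hex) :=
    run_eq_of_le (step_of_halted (Nat.find_spec hex)) hle
  refine ⟨Nat.find hex, Nat.find_spec hex, heq ▸ hr, heq ▸ ho, fun s hs => ?_⟩
  have h1 : U.halted (U.run y p s).1 = false := by simpa using Nat.find_min hex hs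
  -- A starved state is fixed by `step`, so the machine would still be unhalted at its first halting
  -- time.
  refine ⟨h1, fun hst => ?_⟩
  have := run_eq_of_le (step_of_starved hst) hs.le
  have h2 := Nat.find_spec hex
  rw [this, h1] at h2
  exact absurd h2 (by simp)

/-- The state `s` with the string `q` put behind the unread part of the input. -/
def appendInput (q : List Bool) (s : U.State) : U.State := (s.1, s.2.1 ++ q, s.2.2)

theorem step_appendInput (q : List Bool) {s : U.State} (h : ¬ Starved s) :
    U.step (appendInput q s) = appendInput q (U.step s) := by
  obtain ⟨c, l, o⟩ := s
  by_cases h1 : U.halted c = true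
  · simp [step, appendInput, h1]
  · by_cases h2 : U.reads c = true
    · cases l with
      | nil => exact absurd ⟨by simpa using h1, h2, rfl⟩ h
      | cons b l => simp [step, appendInput, h1, h2]
    · simp [step, appendInput, h1, h2]

theorem run_append {y : ℕ} {p : List Bool} (q : List Bool) {t : ℕ}
    (h : ∀ s < t, ¬ Starved (U.run y p s)) :
    U.run y (p ++ q) t = appendInput q (U.run y p t) := by
  induction t with
  | zero => rfl
  | succ t ih =>
    rw [run_succ, run_succ, ih fun s hs => h s (hs.trans t.lt_succ_self),
      step_appendInput q (h t t.lt_succ_self)]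

/-- On `p ++ q` the machine repeats its run on `p` and halts with `q` unread. Halted states are
fixed, so the input can be used up only if `q` is empty. -/
theorem Returns.prefix_free {y : ℕ} {p q : List Bool} {x x' : ℕ} (h : U.Returns y p x)
    (h' : U.Returns y (p ++ q) x') : q = [] ∧ x = x' := by
  obtain ⟨t, ht, hr, ho, hs⟩ := h.exists_first
  obtain ⟨t', ht', hr', ho'⟩ := h'
  have h1 := run_append q fun s hst => (hs s hst).2
  have h2 : U.halted (U.run y (p ++ q) t).1 = true := by rw [h1]; exact ht
  have h3 : U.run y (p ++ q) t = U.run y (p ++ q) t' := by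
    rcases le_total t t' with hle | hle
    · exact (run_eq_of_le (step_of_halted h2) hle).symm
    · exact run_eq_of_le (step_of_halted ht') hle
  rw [← h3, h1] at hr' ho'
  simp only [appendInput, hr, ho, List.nil_append] at hr' ho'
  exact ⟨hr', by simpa using ho'⟩

theorem Returns.unique {y : ℕ} {p : List Bool} {x x' : ℕ} (h : U.Returns y p x)
    (h' : U.Returns y p x') : x = x' :=
  (h.prefix_free (q := []) (by simpa using h')).2

theorem Returns.eq_of_append_eq {y : ℕ} {p p' q q' : List Bool} {x x' : ℕ} (h : U.Returns y p x)
    (h' : U.Returns y p' x') (he : p ++ q = p' ++ q') : p = p' ∧ q = q' := by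
  rcases List.append_eq_append_iff.1 he with ⟨a, rfl, rfl⟩ | ⟨a, rfl, rfl⟩
  · have := (h.prefix_free h').1
    subst this; simp
  · have := (h'.prefix_free h).1
    subst this; simp

variable (U)

/-! ### Post-processing -/

/-- The machine that does on auxiliary input `y` what `U` does on auxiliary input `h y`, but
prints `g y w` in place of `w`. -/
def postprocess (h : ℕ → ℕ) (g : ℕ → ℕ → ℕ) (hh : Computable h) (hg : Computable₂ g) : Machine where
  Config := ℕ × U.Config
  init y := (y, U.init (h y))
  halted c := U.halted c.2
  reads c := U.reads c.2
  print c := (U.print c.2).map (g c.1)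
  next c b := (c.1, U.next c.2 b)
  computable_init := Computable.pair Computable.id (U.computable_init.comp hh)
  computable_halted := U.computable_halted.comp Computable.snd
  computable_reads := U.computable_reads.comp Computable.snd
  computable_print := Computable.option_map (U.computable_print.comp Computable.snd)
    (hg.comp (Computable.fst.comp Computable.fst) Computable.snd).to₂
  computable_next := Computable.pair (Computable.fst.comp Computable.fst)
    (U.computable_next.comp (Computable.snd.comp Computable.fst) Computable.snd)

section

variable {U} {h : ℕ → ℕ} {g : ℕ → ℕ → ℕ} {hh : Computable h} {hg : Computable₂ g}

theorem postprocess_run (y : ℕ) (p : List Bool) (t : ℕ) :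
    (U.postprocess h g hh hg).run y p t =
      ((y, (U.run (h y) p t).1), (U.run (h y) p t).2.1, (U.run (h y) p t).2.2.map (g y)) := by
  induction t with
  | zero => rfl
  | succ t ih =>
    rw [run_succ, run_succ, ih]
    generalize U.run (h y) p t = s
    obtain ⟨c, l, o⟩ := s
    by_cases h1 : U.halted c = true
    · simp [step, postprocess, h1]
    · have hp : (Option.map (g y) (U.print c)).toList = (U.print c).toList.map (g y) := by
        cases U.print c <;> rfl
      by_cases h2 : U.reads c = true
      · cases l with
        | nil => simp [step, postprocess, h1, h2]
        | cons b l => simp [step, postprocess, h1, h2, hp]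
      · simp [step, postprocess, h1, h2, hp]

theorem Returns.postprocess {y : ℕ} {p : List Bool} {w : ℕ} (hr : U.Returns (h y) p w) :
    (U.postprocess h g hh hg).Returns y p (g y w) := by
  obtain ⟨t, h1, h2, h3⟩ := hr
  refine ⟨t, ?_⟩
  rw [postprocess_run]
  exact ⟨h1, h2, by simp [h3]⟩

theorem postprocess_prints {y : ℕ} {p : List Bool} {i w : ℕ} :
    (U.postprocess h g hh hg).Prints y p i w ↔ ∃ v, U.Prints (h y) p i v ∧ g y v = w := by
  simp only [Prints, postprocess_run, List.getElem?_map, Option.map_eq_some_iff]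
  constructor
  · rintro ⟨t, v, hv, e⟩; exact ⟨v, ⟨t, hv⟩, e⟩
  · rintro ⟨v, ⟨t, hv⟩, e⟩; exact ⟨t, v, hv, e⟩

theorem postprocess_starves {y : ℕ} {p : List Bool} :
    (U.postprocess h g hh hg).Starves y p ↔ U.Starves (h y) p := by
  simp only [Starves, postprocess_run]
  rfl

end

/-! ### Constant output -/

/-- The machine that prints `w` and halts. -/
def constant (w : ℕ) : Machine where
  Config := Bool
  init _ := false
  halted c := c
  reads _ := false
  print _ := some w
  next _ _ := true
  computable_init := Computable.const _
  computable_halted := Computable.id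
  computable_reads := Computable.const _
  computable_print := Computable.const _
  computable_next := (Computable.const true).to₂

theorem constant_returns (w y : ℕ) : (constant w).Returns y [] w :=
  ⟨1, by simp [run, step, constant]⟩

/-! ### Sampling -/

/-- The number with the binary digits `l`, the least significant one coming first. -/
def bitsValue (l : List Bool) : ℕ := l.foldr (fun b a => 2 * a + b.toNat) 0

theorem exists_bitsValue_eq {L t : ℕ} (ht : t < 2 ^ L) :
    ∃ l : List Bool, l.length = L ∧ bitsValue l = t := by
  induction L generalizing t with
  | zero => exact ⟨[], rfl, by simp at ht; simp [bitsValue, ht]⟩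
  | succ L ih =>
    obtain ⟨l, hl, hv⟩ := ih (t := t / 2) (by omega)
    refine ⟨(t.bodd) :: l, by simp [hl], ?_⟩
    have : bitsValue (t.bodd :: l) = 2 * bitsValue l + t.bodd.toNat := rfl
    rw [this, hv]
    have := Nat.mod_two_of_bodd t
    have := Nat.div_add_mod t 2
    omega

theorem primrec_bitsValue : Primrec bitsValue :=
  Primrec.list_foldr Primrec.id (Primrec.const 0)
    (Primrec.nat_add.comp
      (Primrec.nat_mul.comp (Primrec.const 2) (Primrec.snd.comp Primrec.snd))
      ((Primrec.dom_bool Bool.toNat).comp (Primrec.fst.comp Primrec.snd))).to₂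

section

variable (h : ℕ → ℕ) (S : ℕ → ℕ → List ℕ)

/-- A configuration of the sampler: its auxiliary input, the simulated configuration and what it
has printed, the bits read after the end of the simulation, and whether the sampler has halted. -/
abbrev SamplerConfig : Type := ((ℕ × (U.Config × List ℕ)) × List Bool) × Bool

/-- The list from which the sampler takes its output. -/
def samplerList (c : U.SamplerConfig) : List ℕ := S c.1.1.1 c.1.1.2.2.headI

/-- Whether the sampler has not yet read as many bits as its list is long. -/
def samplerWaits (c : U.SamplerConfig) : Bool := decide (c.1.2.length < (U.samplerList S c).length)

variable {S}

theorem computable_samplerList (hS : Computable₂ S) : Computable (U.samplerList S) :=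
  hS.comp (Computable.fst.comp (Computable.fst.comp Computable.fst))
    (Primrec.list_headI.to_comp.comp (Computable.snd.comp (Computable.snd.comp
      (Computable.fst.comp Computable.fst))))

theorem computable_samplerBits : Computable fun c : U.SamplerConfig => c.1.2 :=
  Computable.snd.comp Computable.fst

theorem computable_samplerSim : Computable fun c : U.SamplerConfig => c.1.1.2.1 :=
  Computable.fst.comp (Computable.snd.comp (Computable.fst.comp Computable.fst))

theorem computable_samplerPrinted : Computable fun c : U.SamplerConfig => c.1.1.2.2 :=
  Computable.snd.comp (Computable.snd.comp (Computable.fst.comp Computable.fst))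

theorem computable_samplerWaits (hS : Computable₂ S) : Computable (U.samplerWaits S) := by
  have h1 : Computable₂ fun a b : ℕ => decide (a < b) :=
    (primrecRel_iff_primrec_decide.1 Primrec.nat_lt).to_comp
  exact h1.comp (Computable.list_length.comp U.computable_samplerBits)
    (Computable.list_length.comp (U.computable_samplerList hS))

/-- The entry of the sampler's list that is selected by the bits read. -/
def samplerOutput (S : ℕ → ℕ → List ℕ) (c : U.SamplerConfig) : ℕ :=
  (U.samplerList S c).getD (bitsValue c.1.2 % (U.samplerList S c).length) 0

theorem computable_samplerOutput (hS : Computable₂ S) : Computable (U.samplerOutput S) := by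
  have h1 : Computable₂ fun (l : List ℕ) (n : ℕ) => l.getD n 0 := (Primrec.list_getD 0).to_comp
  have h2 : Computable₂ fun a b : ℕ => a % b := Primrec.nat_mod.to_comp
  exact h1.comp (U.computable_samplerList hS)
    (h2.comp (primrec_bitsValue.to_comp.comp U.computable_samplerBits)
      (Computable.list_length.comp (U.computable_samplerList hS)))

/-- One step of the sampler after the end of the simulation. -/
def samplerCollect (S : ℕ → ℕ → List ℕ) (c : U.SamplerConfig) (b : Option Bool) :
    U.SamplerConfig :=
  bif U.samplerWaits S c then ((c.1.1, c.1.2 ++ [b.getD false]), false) else (c.1, true)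

theorem computable_samplerCollect (hS : Computable₂ S) : Computable₂ (U.samplerCollect S) := by
  have h1 : Computable fun a : U.SamplerConfig × Option Bool => a.1.1.1 :=
    Computable.fst.comp (Computable.fst.comp Computable.fst)
  have h2 : Computable fun a : U.SamplerConfig × Option Bool => a.1.1.2 ++ [a.2.getD false] :=
    Computable.list_concat.comp (U.computable_samplerBits.comp Computable.fst)
      (Computable.option_getD Computable.snd (Computable.const false))
  have h3 : Computable fun a : U.SamplerConfig × Option Bool => a.1.1 :=
    Computable.fst.comp Computable.fst
  exact Computable.cond ((U.computable_samplerWaits hS).comp Computable.fst)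
    (Computable.pair (Computable.pair h1 h2) (Computable.const false))
    (Computable.pair h3 (Computable.const true))

/-- One step of the sampler during the simulation. -/
def samplerSimulate (c : U.SamplerConfig) (b : Option Bool) : U.SamplerConfig :=
  (((c.1.1.1, (U.next c.1.1.2.1 b, c.1.1.2.2 ++ (U.print c.1.1.2.1).toList)), c.1.2), false)

theorem computable_samplerSimulate : Computable₂ U.samplerSimulate := by
  have hc : Computable fun a : U.SamplerConfig × Option Bool => a.1.1.1.2.1 :=
    U.computable_samplerSim.comp Computable.fst
  have h1 : Computable fun a : U.SamplerConfig × Option Bool => a.1.1.1.1 :=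
    Computable.fst.comp (Computable.fst.comp (Computable.fst.comp Computable.fst))
  have h2 : Computable fun a : U.SamplerConfig × Option Bool => U.next a.1.1.1.2.1 a.2 :=
    U.computable_next.comp hc Computable.snd
  have h3 : Computable fun a : U.SamplerConfig × Option Bool =>
      a.1.1.1.2.2 ++ (U.print a.1.1.1.2.1).toList :=
    Computable.list_append.comp (U.computable_samplerPrinted.comp Computable.fst)
      (Primrec.optionToList.to_comp.comp (U.computable_print.comp hc))
  have h4 : Computable fun a : U.SamplerConfig × Option Bool => a.1.1.2 :=
    U.computable_samplerBits.comp Computable.fst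
  exact Computable.pair (Computable.pair (Computable.pair h1 (Computable.pair h2 h3)) h4)
    (Computable.const false)

theorem computable_samplerHalted :
    Computable fun c : U.SamplerConfig => U.halted c.1.1.2.1 :=
  U.computable_halted.comp U.computable_samplerSim

variable (S)

/-- The machine that simulates `U` with auxiliary input `h y` until it halts with the output `w`,
then reads as many bits as the list `S y w` is long, and prints the entry of that list which these
bits select. -/
def sampler (hh : Computable h) (hS : Computable₂ S) : Machine where
  Config := U.SamplerConfig
  init y := (((y, (U.init (h y), [])), []), false)
  halted c := c.2
  reads c := bif U.halted c.1.1.2.1 then U.samplerWaits S c else U.reads c.1.1.2.1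
  print c := bif U.halted c.1.1.2.1 then
      bif U.samplerWaits S c then none else some (U.samplerOutput S c)
    else none
  next c b := bif U.halted c.1.1.2.1 then U.samplerCollect S c b else U.samplerSimulate c b
  computable_init := Computable.pair (Computable.pair (Computable.pair Computable.id
    (Computable.pair (U.computable_init.comp hh) (Computable.const []))) (Computable.const []))
    (Computable.const false)
  computable_halted := Computable.snd
  computable_reads := Computable.cond U.computable_samplerHalted (U.computable_samplerWaits hS)
    (U.computable_reads.comp U.computable_samplerSim)
  computable_print := Computable.cond U.computable_samplerHalted
    (Computable.cond (U.computable_samplerWaits hS) (Computable.const none)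
      (Computable.option_some.comp (U.computable_samplerOutput hS)))
    (Computable.const none)
  computable_next := Computable.cond (U.computable_samplerHalted.comp Computable.fst)
    (U.computable_samplerCollect hS) U.computable_samplerSimulate

end

/-! ### Correctness of the sampler -/

section

variable {U} {h : ℕ → ℕ} {S : ℕ → ℕ → List ℕ} {hh : Computable h} {hS : Computable₂ S}

theorem sampler_run {y : ℕ} {p : List Bool} (q : List Bool) {t : ℕ}
    (ht : ∀ s < t, U.halted (U.run (h y) p s).1 = false ∧ ¬ Starved (U.run (h y) p s)) :
    (U.sampler h S hh hS).run y (p ++ q) t =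
      ((((y, ((U.run (h y) p t).1, (U.run (h y) p t).2.2)), []), false),
        (U.run (h y) p t).2.1 ++ q, []) := by
  induction t with
  | zero => rfl
  | succ t ih =>
    rw [run_succ, run_succ, ih fun s hs => ht s (hs.trans t.lt_succ_self)]
    obtain ⟨h1, hs⟩ := ht t t.lt_succ_self
    generalize U.run (h y) p t = s at h1 hs
    obtain ⟨c, l, o⟩ := s
    simp only at h1
    by_cases h2 : U.reads c = true
    · cases l with
      | nil => exact absurd ⟨h1, h2, rfl⟩ hs
      | cons b l => simp [step, sampler, samplerSimulate, h1, h2]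
    · simp [step, sampler, samplerSimulate, h1, h2]

theorem sampler_collect {y w : ℕ} {c : U.Config} (hc : U.halted c = true) (q b : List Bool)
    (hb : b.length + q.length = (S y w).length) :
    (U.sampler h S hh hS).step^[q.length] ((((y, (c, [w])), b), false), q, []) =
      ((((y, (c, [w])), b ++ q), false), [], []) := by
  induction q generalizing b with
  | nil => rw [List.append_nil]; rfl
  | cons a q ih =>
    have hw : U.samplerWaits S (((y, (c, [w])), b), false) = true := by
      rw [List.length_cons] at hb
      exact decide_eq_true (show b.length < (S y w).length by omega)
    have : (U.sampler h S hh hS).step ((((y, (c, [w])), b), false), a :: q, []) =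
        ((((y, (c, [w])), b ++ [a]), false), q, []) := by
      simp [step, sampler, samplerCollect, hc, hw]
    have h2 := ih (b ++ [a]) (by rw [List.length_cons] at hb; simp; omega)
    rw [List.append_assoc, List.singleton_append] at h2
    exact (congrArg (U.sampler h S hh hS).step^[q.length] this).trans h2

theorem Returns.sampler {y w : ℕ} {p : List Bool} (hr : U.Returns (h y) p w) {q : List Bool}
    (hq : q.length = (S y w).length) :
    (U.sampler h S hh hS).Returns y (p ++ q)
      ((S y w).getD (bitsValue q % (S y w).length) 0) := by
  obtain ⟨t, h1, h2, h3, h4⟩ := hr.exists_first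
  have hrun := sampler_run (hh := hh) (hS := hS) q h4
  rw [h2, h3, List.nil_append] at hrun
  have hcol := sampler_collect (h := h) (hh := hh) (hS := hS) h1 q [] (by simpa using hq)
  have hw : U.samplerWaits S (((y, ((U.run (h y) p t).1, [w])), q), false) = false := by
    simp [samplerWaits, samplerList, hq]
  -- There are `t` simulated steps, one step for each bit of `q`, and a last one that prints and
  -- halts.
  refine ⟨1 + (q.length + t), ?_⟩
  have : (U.sampler h S hh hS).run y (p ++ q) (1 + (q.length + t)) =
      (U.sampler h S hh hS).step ((U.sampler h S hh hS).step^[q.length]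
        ((U.sampler h S hh hS).run y (p ++ q) t)) := by
    rw [run, Function.iterate_add_apply, Function.iterate_add_apply]
    rfl
  have hlast := (congrArg (fun s => (U.sampler h S hh hS).step
    ((U.sampler h S hh hS).step^[q.length] s)) hrun).trans
    (congrArg (U.sampler h S hh hS).step hcol)
  rw [this]
  refine Eq.mpr (congrArg (fun s : (U.sampler h S hh hS).State =>
    (U.sampler h S hh hS).halted s.1 = true ∧ s.2.1 = [] ∧ s.2.2 = _) hlast) ?_
  simp [step, Machine.sampler, samplerCollect, samplerOutput, h1, hw, samplerList]

end

end Machine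
/-! ### Kraft's inequality -/

/-- The empty word has to be excluded: with it, `[]` and `[[]]` would have the same concatenation.
-/
theorem uniquelyDecodable_of_prefix_free {S : Set (List Bool)} (h0 : [] ∉ S)
    (hS : ∀ p q, p ∈ S → p ++ q ∈ S → q = []) : InformationTheory.UniquelyDecodable S := by
  intro L₁ L₂ h₁ h₂ h
  induction L₁ generalizing L₂ with
  | nil =>
    cases L₂ with
    | nil => rfl
    | cons a L =>
      have : a = [] := by simp at h; exact h.1
      exact absurd (h₂ a (by simp)) (this ▸ h0)
  | cons a L₁ ih =>
    cases L₂ with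
    | nil =>
      have : a = [] := by simp at h; exact h.1
      exact absurd (h₁ a (by simp)) (this ▸ h0)
    | cons b L₂ =>
      have ha := h₁ a (by simp)
      have hb := h₂ b (by simp)
      rw [List.flatten_cons, List.flatten_cons] at h
      have hab : a = b ∧ L₁.flatten = L₂.flatten := by
        rcases List.append_eq_append_iff.1 h with ⟨c, rfl, hc⟩ | ⟨c, rfl, hc⟩
        · have := hS _ _ ha hb
          subst this; simpa using hc
        · have := hS _ _ hb ha
          subst this; simpa using hc.symm
      rw [hab.1, ih L₂ (fun w hw => h₁ w (by simp [hw])) (fun w hw => h₂ w (by simp [hw])) hab.2]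

theorem kraft_of_prefix_free {S : Finset (List Bool)}
    (hS : ∀ p q, p ∈ S → p ++ q ∈ S → q = []) : ∑ w ∈ S, (2⁻¹ : ℝ≥0∞) ^ w.length ≤ 1 := by
  by_cases h0 : [] ∈ S
  · have : S = {[]} := by
      ext w
      simp only [Finset.mem_singleton]
      exact ⟨fun hw => hS [] w h0 (by simpa using hw), fun hw => hw ▸ h0⟩
    simp [this]
  · have h := InformationTheory.kraft_mcmillan_inequality
      (uniquelyDecodable_of_prefix_free (S := (S : Set (List Bool))) (by simpa using h0)
        (by simpa using hS))
    have h2 : ∑ w ∈ S, (2⁻¹ : ℝ≥0∞) ^ w.length =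
        ENNReal.ofReal (∑ w ∈ S, (1 / Fintype.card Bool : ℝ) ^ w.length) := by
      rw [ENNReal.ofReal_sum_of_nonneg fun _ _ => by positivity]
      refine Finset.sum_congr rfl fun w _ => ?_
      rw [ENNReal.ofReal_pow (by positivity)]
      congr 1
      rw [Fintype.card_bool, one_div, ENNReal.ofReal_inv_of_pos (by norm_num)]
      simp
    rw [h2]
    exact ENNReal.ofReal_le_one.2 h

namespace Machine

variable {U : Machine}

theorem tsum_prob_mul (y : ℕ) (F : ℕ → ℝ≥0∞) :
    ∑' x, U.prob y x * F x =
      ∑' s : (x : ℕ) × {p : List Bool // U.Returns y p x}, 2⁻¹ ^ s.2.1.length * F s.1 := by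
  rw [ENNReal.tsum_sigma']
  exact tsum_congr fun x => ENNReal.tsum_mul_right.symm

/-- A program has at most one output, so the double sum over outputs and their programs runs over
each halting program once, and Kraft's inequality applies. -/
theorem tsum_prob_le_one (y : ℕ) : ∑' x, U.prob y x ≤ 1 := by
  have h := tsum_prob_mul (U := U) y fun _ => 1
  simp only [mul_one] at h
  rw [h, ENNReal.tsum_eq_iSup_sum]
  refine iSup_le fun s => ?_
  have hinj : Set.InjOn (fun a : (x : ℕ) × {p : List Bool // U.Returns y p x} => a.2.1) s := by
    rintro ⟨x, p, hp⟩ - ⟨x', p', hp'⟩ - hpp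
    simp only at hpp
    subst hpp
    cases hp.unique hp'
    rfl
  rw [← Finset.sum_image (f := fun p : List Bool => (2⁻¹ : ℝ≥0∞) ^ p.length) hinj]
  refine kraft_of_prefix_free fun p q hp hq => ?_
  obtain ⟨⟨x, p, hx⟩, -, rfl⟩ := Finset.mem_image.1 hp
  obtain ⟨⟨x', p', hx'⟩, -, hq'⟩ := Finset.mem_image.1 hq
  simp only at hq'
  subst hq'
  exact (hx.prefix_free hx').1

theorem prob_le_one (y x : ℕ) : U.prob y x ≤ 1 :=
  (ENNReal.le_tsum x).trans (tsum_prob_le_one y)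

theorem prob_ne_top (y x : ℕ) : U.prob y x ≠ ∞ :=
  ((prob_le_one y x).trans_lt ENNReal.one_lt_top).ne

/-! ### Domination -/

/-- Every program `p` of `M` becomes the program `r ++ p` of `U`, at the price of the factor 2 ^
(-|r|). -/
theorem IsUniversal.prob_le (hU : U.IsUniversal) (M : Machine) :
    ∃ N : ℕ, ∀ y x, 2⁻¹ ^ N * M.prob y x ≤ U.prob y x := by
  obtain ⟨r, hr⟩ := hU M
  refine ⟨r.length, fun y x => ?_⟩
  rw [prob, prob, ← ENNReal.tsum_mul_left]
  let f : {p : List Bool // M.Returns y p x} → {p : List Bool // U.Returns y p x} :=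
    fun p => ⟨r ++ p.1, ((hr y p.1).1 x).2 p.2⟩
  have hf : Function.Injective f := fun p q h => by
    simpa [f, Subtype.ext_iff] using h
  refine le_trans (ENNReal.tsum_le_tsum fun p => ?_)
    (ENNReal.tsum_comp_le_tsum_of_injective hf fun p => 2⁻¹ ^ p.1.length)
  simp [f, pow_add]

theorem IsUniversal.prob_pos (hU : U.IsUniversal) (y x : ℕ) : 0 < U.prob y x := by
  obtain ⟨N, hN⟩ := hU.prob_le (constant x)
  refine lt_of_lt_of_le ?_ (hN y x)
  refine ENNReal.mul_pos (by simp) (ne_of_gt ?_)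
  refine lt_of_lt_of_le ?_ (ENNReal.le_tsum ⟨[], constant_returns x y⟩)
  simp

theorem IsUniversal.prob_map_le (hU : U.IsUniversal) {h : ℕ → ℕ} {g : ℕ → ℕ → ℕ}
    (hh : Computable h) (hg : Computable₂ g) :
    ∃ N : ℕ, ∀ y w, 2⁻¹ ^ N * U.prob (h y) w ≤ U.prob y (g y w) := by
  obtain ⟨N, hN⟩ := hU.prob_le (U.postprocess h g hh hg)
  refine ⟨N, fun y w => le_trans ?_ (hN y _)⟩
  gcongr
  let f : {p : List Bool // U.Returns (h y) p w} →
      {p : List Bool // (U.postprocess h g hh hg).Returns y p (g y w)} :=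
    fun p => ⟨p.1, p.2.postprocess⟩
  have hf : Function.Injective f := fun p q h => by
    simpa [f, Subtype.ext_iff] using h
  exact ENNReal.tsum_comp_le_tsum_of_injective hf fun p => 2⁻¹ ^ p.1.length

/-- `L` random bits reduced modulo `L` hit each residue at least `q = 2 ^ L / L` times out of `2 ^
L`. As `q ≥ 1`, the rounding loses at most a factor 2: `2 ^ L < L * (q + 1) ≤ 2 * L * q`. This
avoids exact uniform sampling from a list whose length is not a power of two. -/
theorem sum_range_div_le (L : ℕ) (f : ℕ → ℝ≥0∞) :
    (∑ i ∈ Finset.range L, f i) / (2 * L) ≤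
      2⁻¹ ^ L * ∑ t ∈ Finset.range (2 ^ L), f (t % L) := by
  rcases Nat.eq_zero_or_pos L with rfl | hL
  · simp
  set q := 2 ^ L / L with hq
  have h1 : ∀ a : ℕ, ∑ t ∈ Finset.range (a * L), f (t % L) = a * ∑ i ∈ Finset.range L, f i := by
    intro a
    induction a with
    | zero => simp
    | succ a ih =>
      rw [Nat.succ_mul, Finset.sum_range_add, ih]
      push_cast
      rw [add_mul, one_mul]
      congr 1
      refine Finset.sum_congr rfl fun i hi => ?_
      rw [add_comm, Nat.add_mul_mod_self_right, Nat.mod_eq_of_lt (Finset.mem_range.1 hi)]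
  have h2 : (q : ℝ≥0∞) * ∑ i ∈ Finset.range L, f i ≤ ∑ t ∈ Finset.range (2 ^ L), f (t % L) := by
    rw [← h1]
    exact Finset.sum_le_sum_of_subset
      (Finset.range_subset_range.2 (Nat.div_mul_le_self _ _))
  have h3 : 2 ^ L ≤ q * (2 * L) := by
    have h4 : 1 ≤ q := (Nat.one_le_div_iff hL).2 Nat.lt_two_pow_self.le
    have h5 : 2 ^ L < L * (q + 1) := Nat.lt_mul_div_succ _ hL
    nlinarith
  refine ENNReal.div_le_of_le_mul ?_
  calc ∑ i ∈ Finset.range L, f i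
      = 2⁻¹ ^ L * 2 ^ L * ∑ i ∈ Finset.range L, f i := by
        rw [← mul_pow, ENNReal.inv_mul_cancel (by simp) (by simp), one_pow, one_mul]
    _ ≤ 2⁻¹ ^ L * (q * (2 * L)) * ∑ i ∈ Finset.range L, f i := by
        gcongr
        exact_mod_cast h3
    _ = 2⁻¹ ^ L * (q * ∑ i ∈ Finset.range L, f i) * (2 * L) := by ring
    _ ≤ _ := by gcongr

theorem list_sum_div_le (l : List ℕ) (F : ℕ → ℝ≥0∞) :
    (l.map F).sum / (2 * l.length) ≤
      2⁻¹ ^ l.length * ∑ t ∈ Finset.range (2 ^ l.length), F (l.getD (t % l.length) 0) := by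
  have : (l.map F).sum = ∑ i ∈ Finset.range l.length, F (l.getD i 0) := by
    rw [Finset.sum_range, ← List.sum_ofFn]
    congr 1
    apply List.ext_getElem <;> simp
  rw [this]
  exact sum_range_div_le l.length fun i => F (l.getD i 0)

/-- A program of `U` followed by selection bits is a program of the sampler. By prefix-freeness the
concatenation determines both parts, so these programs give a subfamily of the sampler's programs.
-/
theorem IsUniversal.prob_sample_le (hU : U.IsUniversal) {h : ℕ → ℕ} {S : ℕ → ℕ → List ℕ}
    (hh : Computable h) (hS : Computable₂ S) :
    ∃ N : ℕ, ∀ (y : ℕ) (F : ℕ → ℝ≥0∞),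
      2⁻¹ ^ N * ∑' w, U.prob (h y) w * (((S y w).map F).sum / (2 * (S y w).length)) ≤
        ∑' x, U.prob y x * F x := by
  obtain ⟨N, hN⟩ := hU.prob_le (U.sampler h S hh hS)
  refine ⟨N, fun y F => ?_⟩
  have hM : 2⁻¹ ^ N * ∑' x, (U.sampler h S hh hS).prob y x * F x ≤ ∑' x, U.prob y x * F x := by
    rw [← ENNReal.tsum_mul_left]
    refine ENNReal.tsum_le_tsum fun x => ?_
    rw [← mul_assoc]
    gcongr
    exact hN y x
  refine le_trans ?_ hM
  gcongr 2⁻¹ ^ N * ?_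
  rw [tsum_prob_mul, tsum_prob_mul]
  choose bits hbits using fun (w : ℕ) (t : Fin (2 ^ (S y w).length)) => exists_bitsValue_eq t.2
  let I := (s : (w : ℕ) × {p : List Bool // U.Returns (h y) p w}) × Fin (2 ^ (S y s.1).length)
  let f : I → (x : ℕ) × {p : List Bool // (U.sampler h S hh hS).Returns y p x} := fun s =>
    ⟨_, s.1.2.1 ++ bits s.1.1 s.2, s.1.2.2.sampler (hbits _ s.2).1⟩
  have hf : Function.Injective f := by
    rintro ⟨⟨w, p, hp⟩, t⟩ ⟨⟨w', p', hp'⟩, t'⟩ he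
    have he' : p ++ bits w t = p' ++ bits w' t' := congrArg (fun s => s.2.1) he
    obtain ⟨rfl, hb⟩ := hp.eq_of_append_eq hp' he'
    cases hp.unique hp'
    have : t = t' := Fin.ext (by rw [← (hbits w t).2, hb, (hbits w t').2])
    rw [this]
  refine le_trans ?_ (ENNReal.tsum_comp_le_tsum_of_injective hf _)
  refine le_trans (ENNReal.tsum_le_tsum fun s => ?_) (ENNReal.tsum_sigma' _).ge
  rw [tsum_fintype]
  refine (mul_le_mul_right (list_sum_div_le _ F) _).trans (le_of_eq ?_)
  rw [Finset.sum_range, Finset.mul_sum, Finset.mul_sum]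
  refine Finset.sum_congr rfl fun t _ => ?_
  simp only [f, List.length_append, (hbits _ t).1, (hbits _ t).2, pow_add]
  ring

end Machine
/-! ### Computable rational arithmetic -/

/-- Codes of rationals are in lowest terms, and elementary objects are recognized only by these
codes. A machine that computes with them must therefore cancel common factors. -/
theorem primrec_gcd : Primrec₂ Nat.gcd := by
  have hdvd : PrimrecRel fun (a : ℕ × ℕ) (g : ℕ) => a.1 % g = 0 ∧ a.2 % g = 0 :=
    (Primrec.eq.comp (Primrec.nat_mod.comp (Primrec.fst.comp Primrec.fst) Primrec.snd)
      (Primrec.const 0)).and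
    (Primrec.eq.comp (Primrec.nat_mod.comp (Primrec.snd.comp Primrec.fst) Primrec.snd)
      (Primrec.const 0))
  have h := Primrec.nat_findGreatest (Primrec.nat_add.comp Primrec.fst Primrec.snd) hdvd
  refine h.of_eq fun a => ?_
  rw [Nat.findGreatest_eq_iff]
  simp only [← Nat.dvd_iff_mod_eq_zero]
  refine ⟨?_, fun _ => ⟨Nat.gcd_dvd_left _ _, Nat.gcd_dvd_right _ _⟩, ?_⟩
  · rcases Nat.eq_zero_or_pos a.1 with h0 | h0
    · simp [h0]
    · exact (Nat.gcd_le_left _ h0).trans (Nat.le_add_right _ _)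
  · rintro g hg hga ⟨h1, h2⟩
    have h3 := Nat.dvd_gcd h1 h2
    rcases Nat.eq_zero_or_pos (a.1.gcd a.2) with h0 | h0
    · rw [Nat.gcd_eq_zero_iff] at h0
      omega
    · exact absurd (Nat.le_of_dvd h0 h3) (by omega)

/-- The rational number `(p - n) / d`. -/
def ratValue (t : ℕ × ℕ × ℕ) : ℚ := ((t.1 : ℚ) - t.2.1) / t.2.2

/-- The code of the rational number `(p - n) / d`. -/
def ratNormalize (t : ℕ × ℕ × ℕ) : ℕ × ℕ × ℕ :=
  if t.2.2 = 0 then (0, 0, 1)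
  else ((t.1 - t.2.1) / Nat.gcd ((t.1 - t.2.1) + (t.2.1 - t.1)) t.2.2,
    (t.2.1 - t.1) / Nat.gcd ((t.1 - t.2.1) + (t.2.1 - t.1)) t.2.2,
    t.2.2 / Nat.gcd ((t.1 - t.2.1) + (t.2.1 - t.1)) t.2.2)

theorem ratValue_ratCode (a : ℚ) : ratValue (ratCode a) = a := by
  have h : ((a.num.toNat : ℤ) : ℚ) - (((-a.num).toNat : ℤ) : ℚ) = a.num := by
    rw [← Int.cast_sub]
    congr 1
    omega
  simp only [Int.cast_natCast] at h
  rw [ratValue, ratCode, h, Rat.num_div_den]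

theorem ratCode_ratValue (t : ℕ × ℕ × ℕ) : ratCode (ratValue t) = ratNormalize t := by
  obtain ⟨p, n, d⟩ := t
  rcases Nat.eq_zero_or_pos d with rfl | hd
  · simp [ratValue, ratNormalize, ratCode]
  -- One of the two truncated differences vanishes, so their sum is |p - n| and `g` is the common
  -- factor of numerator and denominator.
  set g := Nat.gcd ((p - n) + (n - p)) d with hg
  have hg0 : 0 < g := Nat.gcd_pos_of_pos_right _ hd
  obtain ⟨d', hd'⟩ : g ∣ d := Nat.gcd_dvd_right _ _
  have hga : g ∣ (p - n) + (n - p) := Nat.gcd_dvd_left _ _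
  have h1 : g ∣ p - n := by
    rcases le_total p n with h | h
    · simp [Nat.sub_eq_zero_of_le h]
    · rwa [Nat.sub_eq_zero_of_le h, add_zero] at hga
  have h2 : g ∣ n - p := by
    rcases le_total p n with h | h
    · rwa [Nat.sub_eq_zero_of_le h, zero_add] at hga
    · simp [Nat.sub_eq_zero_of_le h]
  obtain ⟨p', hp'⟩ := h1
  obtain ⟨n', hn'⟩ := h2
  have hd'0 : 0 < d' := by
    rcases Nat.eq_zero_or_pos d' with h | h
    · simp [h] at hd'; omega
    · exact h
  have hcop : Nat.Coprime (p' + n') d' := by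
    have : g * Nat.gcd (p' + n') d' = g * 1 := by
      rw [← Nat.gcd_mul_left, mul_add, ← hp', ← hn', ← hd', mul_one]
    exact Nat.eq_of_mul_eq_mul_left hg0 this
  have hzero : p' = 0 ∨ n' = 0 := by
    rcases le_total p n with h | h
    · left
      rw [Nat.sub_eq_zero_of_le h] at hp'
      simpa [hg0.ne'] using hp'.symm
    · right
      rw [Nat.sub_eq_zero_of_le h] at hn'
      simpa [hg0.ne'] using hn'.symm
  have hval : ratValue (p, n, d) = (((p' : ℤ) - n' : ℤ) : ℚ) / ((d' : ℤ) : ℚ) := by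
    have h3 : (p : ℚ) - n = g * (p' - n') := by
      have : (p : ℤ) - n = ((p - n : ℕ) : ℤ) - ((n - p : ℕ) : ℤ) := by omega
      rw [hp', hn'] at this
      have h4 : ((p : ℤ) : ℚ) - ((n : ℤ) : ℚ) = (((p : ℤ) - n : ℤ) : ℚ) := by push_cast; ring
      rw [this] at h4
      push_cast at h4
      rw [h4]; ring
    have hgq : (g : ℚ) ≠ 0 := by exact_mod_cast hg0.ne'
    simp only [ratValue]
    rw [h3, hd']
    push_cast
    rw [mul_div_mul_left _ _ hgq]
  have habs : ((p' : ℤ) - n').natAbs = p' + n' := by omega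
  have hnum : (ratValue (p, n, d)).num = (p' : ℤ) - n' := by
    rw [hval]
    exact Rat.num_div_eq_of_coprime (by exact_mod_cast hd'0) (by simpa [habs] using hcop)
  have hden : (ratValue (p, n, d)).den = d' := by
    have : (((ratValue (p, n, d)).den : ℤ)) = d' := by
      rw [hval]
      exact Rat.den_div_eq_of_coprime (by exact_mod_cast hd'0) (by simpa [habs] using hcop)
    exact_mod_cast this
  rw [ratCode, hnum, hden, ratNormalize, if_neg hd.ne', ← hg]
  simp only
  rw [hp', hn', hd', Nat.mul_div_cancel_left _ hg0, Nat.mul_div_cancel_left _ hg0,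
    Nat.mul_div_cancel_left _ hg0]
  refine Prod.ext ?_ (Prod.ext ?_ rfl) <;> simp only <;> omega

theorem primrec_ratNormalize : Primrec ratNormalize := by
  have hd : Primrec fun t : ℕ × ℕ × ℕ => t.2.2 := Primrec.snd.comp Primrec.snd
  have hn : Primrec fun t : ℕ × ℕ × ℕ => t.2.1 := Primrec.fst.comp Primrec.snd
  have h1 : Primrec fun t : ℕ × ℕ × ℕ => t.1 - t.2.1 := Primrec.nat_sub.comp Primrec.fst hn
  have h2 : Primrec fun t : ℕ × ℕ × ℕ => t.2.1 - t.1 := Primrec.nat_sub.comp hn Primrec.fst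
  have hg := primrec_gcd.comp (Primrec.nat_add.comp h1 h2) hd
  exact Primrec.ite (Primrec.eq.comp hd (Primrec.const 0)) (Primrec.const (0, 0, 1))
    (Primrec.pair (Primrec.nat_div.comp h1 hg)
      (Primrec.pair (Primrec.nat_div.comp h2 hg) (Primrec.nat_div.comp hd hg)))

/-- Rational numbers correspond to the codes that are in lowest terms. -/
def ratEquiv : ℚ ≃ {t : ℕ × ℕ × ℕ // ratNormalize t = t} where
  toFun a := ⟨ratCode a, by rw [← ratCode_ratValue, ratValue_ratCode]⟩
  invFun t := ratValue t.1
  left_inv a := ratValue_ratCode a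
  right_inv t := Subtype.ext ((ratCode_ratValue _).trans t.2)

theorem primrecPred_ratNormalize : PrimrecPred fun t : ℕ × ℕ × ℕ => ratNormalize t = t :=
  Primrec.eq.comp primrec_ratNormalize Primrec.id

/-- Computability on `ℚ` refers to the codes `ratCode`. -/
@[reducible] def ratPrimcodable : Primcodable ℚ :=
  letI := Primcodable.subtype primrecPred_ratNormalize
  Primcodable.ofEquiv _ ratEquiv

attribute [local instance] ratPrimcodable

theorem primrec_ratCode : Primrec ratCode :=
  letI := Primcodable.subtype primrecPred_ratNormalize
  (Primrec.subtype_val (hp := primrecPred_ratNormalize)).comp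
    (Primrec.of_equiv (e := ratEquiv))

theorem primrec_ratValue : Primrec ratValue := by
  let := Primcodable.subtype primrecPred_ratNormalize
  refine (Primrec.of_equiv_iff ratEquiv).1 ?_
  refine (Primrec.subtype_val_iff (hp := primrecPred_ratNormalize)).1 ?_
  exact primrec_ratNormalize.of_eq fun t => (ratCode_ratValue t).symm

section

variable {α : Type*} [Primcodable α] {f g : α → ℚ}

theorem primrec_num_toNat (hf : Primrec f) : Primrec fun a => (f a).num.toNat :=
  Primrec.fst.comp (primrec_ratCode.comp hf)

theorem primrec_den (hf : Primrec f) : Primrec fun a => (f a).den :=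
  (Primrec.snd.comp Primrec.snd).comp (primrec_ratCode.comp hf)

theorem primrec_neg_num_toNat (hf : Primrec f) : Primrec fun a => (-(f a).num).toNat :=
  (Primrec.fst.comp Primrec.snd).comp (primrec_ratCode.comp hf)

theorem primrec_rat_cast {f : α → ℕ} (hf : Primrec f) : Primrec fun a => (f a : ℚ) :=
  (primrec_ratValue.comp (Primrec.pair hf (Primrec.const (0, 1)))).of_eq fun a => by
    simp [ratValue]

theorem rat_eq (a : ℚ) : a = ((a.num.toNat : ℚ) - (-a.num).toNat) / a.den :=
  (ratValue_ratCode a).symm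

theorem primrec_rat_add (hf : Primrec f) (hg : Primrec g) : Primrec fun a => f a + g a := by
  refine (primrec_ratValue.comp (Primrec.pair
    (Primrec.nat_add.comp (Primrec.nat_mul.comp (primrec_num_toNat hf) (primrec_den hg))
      (Primrec.nat_mul.comp (primrec_num_toNat hg) (primrec_den hf)))
    (Primrec.pair
      (Primrec.nat_add.comp (Primrec.nat_mul.comp (primrec_neg_num_toNat hf) (primrec_den hg))
        (Primrec.nat_mul.comp (primrec_neg_num_toNat hg) (primrec_den hf)))
      (Primrec.nat_mul.comp (primrec_den hf) (primrec_den hg))))).of_eq fun a => ?_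
  rw [ratValue]
  conv_rhs => rw [rat_eq (f a), rat_eq (g a)]
  have h1 : ((f a).den : ℚ) ≠ 0 := by exact_mod_cast (f a).den_nz
  have h2 : ((g a).den : ℚ) ≠ 0 := by exact_mod_cast (g a).den_nz
  push_cast
  field_simp
  ring

theorem primrec_rat_mul (hf : Primrec f) (hg : Primrec g) : Primrec fun a => f a * g a := by
  refine (primrec_ratValue.comp (Primrec.pair
    (Primrec.nat_add.comp
      (Primrec.nat_mul.comp (primrec_num_toNat hf) (primrec_num_toNat hg))
      (Primrec.nat_mul.comp (primrec_neg_num_toNat hf) (primrec_neg_num_toNat hg)))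
    (Primrec.pair
      (Primrec.nat_add.comp
        (Primrec.nat_mul.comp (primrec_num_toNat hf) (primrec_neg_num_toNat hg))
        (Primrec.nat_mul.comp (primrec_neg_num_toNat hf) (primrec_num_toNat hg)))
      (Primrec.nat_mul.comp (primrec_den hf) (primrec_den hg))))).of_eq fun a => ?_
  rw [ratValue]
  conv_rhs => rw [rat_eq (f a), rat_eq (g a)]
  have h1 : ((f a).den : ℚ) ≠ 0 := by exact_mod_cast (f a).den_nz
  have h2 : ((g a).den : ℚ) ≠ 0 := by exact_mod_cast (g a).den_nz
  push_cast
  field_simp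
  ring

theorem primrec_rat_sub (hf : Primrec f) (hg : Primrec g) : Primrec fun a => f a - g a := by
  refine (primrec_rat_add hf (primrec_rat_mul (Primrec.const (-1)) hg)).of_eq fun a => ?_
  ring

theorem primrec_rat_inv (hf : Primrec f) : Primrec fun a => (f a)⁻¹ := by
  have hle : PrimrecPred fun a => (-(f a).num).toNat ≤ (f a).num.toNat :=
    Primrec.nat_le.comp (primrec_neg_num_toNat hf) (primrec_num_toNat hf)
  refine (primrec_ratValue.comp (Primrec.ite hle
    (Primrec.pair (primrec_den hf) (Primrec.pair (Primrec.const 0) (primrec_num_toNat hf)))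
    (Primrec.pair (Primrec.const 0)
      (Primrec.pair (primrec_den hf) (primrec_neg_num_toNat hf))))).of_eq fun a => ?_
  have h := rat_eq (f a)
  split_ifs with hc
  · have : (-(f a).num).toNat = 0 := by omega
    rw [this] at h
    rw [ratValue]
    conv_rhs => rw [h]
    simp
  · have : (f a).num.toNat = 0 := by omega
    rw [this] at h
    rw [ratValue]
    conv_rhs => rw [h]
    simp [neg_div]

theorem primrec_rat_div (hf : Primrec f) (hg : Primrec g) : Primrec fun a => f a / g a :=
  primrec_rat_mul hf (primrec_rat_inv hg)

theorem primrec_rat_sum {f : α → List ℚ} (hf : Primrec f) : Primrec fun a => (f a).sum :=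
  Primrec.list_foldr hf (Primrec.const 0)
    (primrec_rat_add (Primrec.fst.comp Primrec.snd) (Primrec.snd.comp Primrec.snd)).to₂

theorem primrec_two_pow {f : α → ℕ} (hf : Primrec f) : Primrec fun a => 2 ^ f a := by
  have : Primrec fun n : ℕ => 2 ^ n :=
    (Primrec.nat_rec₁ (f := fun _ b => 2 * b) 1
      (Primrec.nat_mul.comp (Primrec.const 2) Primrec.snd).to₂).of_eq fun n => by
        induction n with
        | zero => rfl
        | succ n ih => rw [pow_succ', ← ih]
  exact this.comp hf

end

/-! ### Codes of elementary vectors and matrices -/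

theorem primrec_gaussCode : Primrec gaussCode :=
  Primrec.pair (primrec_ratCode.comp Primrec.fst) (primrec_ratCode.comp Primrec.snd)

/-- The complex number with the given code. -/
def gaussValue (t : (ℕ × ℕ × ℕ) × (ℕ × ℕ × ℕ)) : ℚ × ℚ := (ratValue t.1, ratValue t.2)

theorem primrec_gaussValue : Primrec gaussValue :=
  Primrec.pair (primrec_ratValue.comp Primrec.fst) (primrec_ratValue.comp Primrec.snd)

theorem gaussValue_gaussCode (z : ℚ × ℚ) : gaussValue (gaussCode z) = z :=
  Prod.ext (ratValue_ratCode _) (ratValue_ratCode _)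

theorem gaussCode_injective : Function.Injective gaussCode :=
  Function.LeftInverse.injective gaussValue_gaussCode

/-- The code of a list of complex numbers. -/
def vecCode (v : List (ℚ × ℚ)) : ℕ := Encodable.encode (v.map gaussCode)

/-- The list of complex numbers with the given code. -/
def vecDecode (w : ℕ) : List (ℚ × ℚ) :=
  ((Encodable.decode (α := List ((ℕ × ℕ × ℕ) × (ℕ × ℕ × ℕ))) w).getD []).map gaussValue

theorem vecDecode_vecCode (v : List (ℚ × ℚ)) : vecDecode (vecCode v) = v := by
  simp [vecDecode, vecCode, Function.comp_def, gaussValue_gaussCode]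

theorem primrec_vecCode : Primrec vecCode :=
  Primrec.encode.comp (Primrec.list_map Primrec.id (primrec_gaussCode.comp Primrec.snd).to₂)

theorem primrec_vecDecode : Primrec vecDecode :=
  Primrec.list_map (Primrec.option_getD.comp Primrec.decode (Primrec.const []))
    (primrec_gaussValue.comp Primrec.snd).to₂

theorem vecCode_ofFn {d : ℕ} (v : Fin d → ℚ × ℚ) :
    vecCode (List.ofFn v) = Encodable.encode (List.ofFn fun i => gaussCode (v i)) := by
  rw [vecCode, List.map_ofFn]; rfl

theorem ElementaryState.code_injective {d : ℕ} :
    Function.Injective (ElementaryState.code (d := d)) := fun v w h => by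
  have h2 := Encodable.encode_injective h
  refine Subtype.ext (funext fun i => gaussCode_injective ?_)
  exact congrFun (List.ofFn_injective h2) i

/-- The code of an elementary matrix, given as the list of its rows. -/
def rowsCode (E : List (List (ℚ × ℚ))) : ℕ := Encodable.encode (E.map fun v => v.map gaussCode)

/-- The list of the rows of the elementary matrix with the given code. -/
def rowsDecode (w : ℕ) : List (List (ℚ × ℚ)) :=
  ((Encodable.decode (α := List (List ((ℕ × ℕ × ℕ) × (ℕ × ℕ × ℕ)))) w).getD []).map
    fun v => v.map gaussValue

theorem rowsDecode_rowsCode (E : List (List (ℚ × ℚ))) : rowsDecode (rowsCode E) = E := by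
  simp [rowsDecode, rowsCode, Function.comp_def, gaussValue_gaussCode]

theorem primrec_rowsCode : Primrec rowsCode :=
  Primrec.encode.comp (Primrec.list_map Primrec.id
    (Primrec.list_map Primrec.snd (primrec_gaussCode.comp Primrec.snd).to₂).to₂)

theorem primrec_rowsDecode : Primrec rowsDecode :=
  Primrec.list_map (Primrec.option_getD.comp Primrec.decode (Primrec.const []))
    (Primrec.list_map Primrec.snd (primrec_gaussValue.comp Primrec.snd).to₂).to₂

theorem rowsCode_ofFn {d : ℕ} (E : Fin d → Fin d → ℚ × ℚ) :
    rowsCode (List.ofFn fun i => List.ofFn (E i)) = matCode E := by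
  simp [rowsCode, matCode, List.map_ofFn, Function.comp_def]

theorem matCode_injective {d : ℕ} : Function.Injective (matCode (d := d)) := fun E F h => by
  rw [← rowsCode_ofFn, ← rowsCode_ofFn] at h
  have h2 := congrArg rowsDecode h
  rw [rowsDecode_rowsCode, rowsDecode_rowsCode] at h2
  funext i
  exact List.ofFn_injective (congrFun (List.ofFn_injective h2) i)

/-! ### A rational vector as a combination of two elementary states

If `|v| ^ 2 = r` and `a` is rational, then `P = (a ^ 2 - r) / (2 (a + v 0))` makes `v + P e₀` a vector
of the rational norm `|a - P|`. -/

/-- A rational number between `2 √r` and `4 √r`. -/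
def approxNorm (r : ℚ) : ℚ := 2 * ((Nat.sqrt (r.num.toNat * r.den) + 1 : ℕ) : ℚ) / (r.den : ℚ)

/-- For `r = p / d` one has √r = √(pd) / d. With `s` the integer part of √(pd), which is at least 1,
√(pd) < s + 1 ≤ 2s ≤ 2√(pd). -/
theorem approxNorm_spec {r : ℚ} (hr : 0 < r) :
    0 < approxNorm r ∧ 4 * r ≤ approxNorm r ^ 2 ∧ approxNorm r ^ 2 ≤ 16 * r := by
  have hd : (0 : ℚ) < r.den := by exact_mod_cast r.den_pos
  set p := r.num.toNat with hp
  set s := Nat.sqrt (p * r.den) with hs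
  have hpr : (p : ℚ) = r * r.den := by
    have h1 : ((p : ℤ) : ℚ) = (r.num : ℚ) := by
      rw [hp, Int.toNat_of_nonneg (Rat.num_pos.2 hr).le]
    rw [Rat.mul_den_eq_num, ← h1]; rfl
  have hp0 : 0 < p * r.den := Nat.mul_pos (by have := Rat.num_pos.2 hr; omega) r.den_pos
  have h1 : p * r.den < (s + 1) * (s + 1) := Nat.lt_succ_sqrt _
  have h2 : s * s ≤ p * r.den := Nat.sqrt_le _
  have h3 : 0 < s := Nat.sqrt_pos.2 hp0
  have h1' : r * r.den * r.den < ((s : ℚ) + 1) * (s + 1) := by rw [← hpr]; exact_mod_cast h1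
  have h2' : (s : ℚ) * s ≤ r * r.den * r.den := by rw [← hpr]; exact_mod_cast h2
  have h3' : (1 : ℚ) ≤ s := by exact_mod_cast h3
  have hrw : approxNorm r ^ 2 = 4 * (((s : ℚ) + 1) * (s + 1)) / (r.den * r.den) := by
    rw [approxNorm, ← hs]; push_cast; field_simp; ring
  refine ⟨?_, ?_, ?_⟩
  · rw [approxNorm]; positivity
  · rw [hrw, le_div_iff₀ (by positivity)]; linarith
  · rw [hrw, div_le_iff₀ (by positivity)]; nlinarith

/-- The square of the norm. -/
def vecNormSq (v : List (ℚ × ℚ)) : ℚ := (v.map fun c => c.1 * c.1 + c.2 * c.2).sum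

/-- The number that has to be added to the first coordinate to make the norm rational. -/
def vecShift (v : List (ℚ × ℚ)) : ℚ :=
  (approxNorm (vecNormSq v) * approxNorm (vecNormSq v) - vecNormSq v) /
    (2 * (approxNorm (vecNormSq v) + v.headI.1))

/-- The norm, up to sign, of the shifted vector. -/
def vecResidue (v : List (ℚ × ℚ)) : ℚ := approxNorm (vecNormSq v) - vecShift v

/-- The shifted vector, normalized. -/
def vecDirection (v : List (ℚ × ℚ)) : List (ℚ × ℚ) :=
  ((v.headI.1 + vecShift v, v.headI.2) :: v.tail).map
    fun c => (c.1 / vecResidue v, c.2 / vecResidue v)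

/-- The first basis vector of the space that contains `v`. -/
def vecFirst (v : List (ℚ × ℚ)) : List (ℚ × ℚ) := (1, 0) :: v.tail.map fun _ => (0, 0)

/-- The vectors that represent `v` in the sampling, with multiplicities: about `M |v| ^ 2` copies
of each. -/
def vecSamples (M : ℕ) (v : List (ℚ × ℚ)) : List ℕ :=
  (List.range (M * (vecNormSq v).num.toNat / (vecNormSq v).den + 1)).flatMap
    fun _ => [vecCode (vecDirection v), vecCode (vecFirst v)]

/-! ### Computability of the decomposition into two states -/

theorem primrec_approxNorm : Primrec approxNorm :=
  primrec_rat_div (primrec_rat_mul (Primrec.const 2) (primrec_rat_cast (Primrec.succ.comp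
    (Primrec.nat_sqrt.comp (Primrec.nat_mul.comp (primrec_num_toNat Primrec.id)
      (primrec_den Primrec.id)))))) (primrec_rat_cast (primrec_den Primrec.id))

theorem primrec_vecNormSq : Primrec vecNormSq := by
  refine primrec_rat_sum (Primrec.list_map Primrec.id ?_)
  have h1 : Primrec fun a : List (ℚ × ℚ) × (ℚ × ℚ) => a.2.1 := Primrec.fst.comp Primrec.snd
  have h2 : Primrec fun a : List (ℚ × ℚ) × (ℚ × ℚ) => a.2.2 := Primrec.snd.comp Primrec.snd
  exact primrec_rat_add (primrec_rat_mul h1 h1) (primrec_rat_mul h2 h2)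

theorem primrec_vecShift : Primrec vecShift := by
  have ha := primrec_approxNorm.comp primrec_vecNormSq
  have h1 : Primrec fun v : List (ℚ × ℚ) => v.headI.1 := Primrec.fst.comp Primrec.list_headI
  exact primrec_rat_div (primrec_rat_sub (primrec_rat_mul ha ha) primrec_vecNormSq)
    (primrec_rat_mul (Primrec.const 2) (primrec_rat_add ha h1))

theorem primrec_vecResidue : Primrec vecResidue :=
  primrec_rat_sub (primrec_approxNorm.comp primrec_vecNormSq) primrec_vecShift

theorem primrec_vecDirection : Primrec vecDirection := by
  have h0 : Primrec fun v : List (ℚ × ℚ) => v.headI := Primrec.list_headI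
  have h1 : Primrec fun v : List (ℚ × ℚ) => (v.headI.1 + vecShift v, v.headI.2) :=
    Primrec.pair (primrec_rat_add (Primrec.fst.comp h0) primrec_vecShift) (Primrec.snd.comp h0)
  refine Primrec.list_map (Primrec.list_cons.comp h1 Primrec.list_tail) ?_
  have hs : Primrec fun a : List (ℚ × ℚ) × (ℚ × ℚ) => vecResidue a.1 :=
    primrec_vecResidue.comp Primrec.fst
  exact Primrec.pair (primrec_rat_div (Primrec.fst.comp Primrec.snd) hs)
    (primrec_rat_div (Primrec.snd.comp Primrec.snd) hs)

theorem primrec_vecFirst : Primrec vecFirst :=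
  Primrec.list_cons.comp (Primrec.const (1, 0))
    (Primrec.list_map Primrec.list_tail (Primrec.const (0, 0)).to₂)

theorem primrec_vecSamples : Primrec₂ vecSamples := by
  have hr : Primrec fun a : ℕ × List (ℚ × ℚ) => vecNormSq a.2 :=
    primrec_vecNormSq.comp Primrec.snd
  have hl : Primrec fun v : List (ℚ × ℚ) => [vecCode (vecDirection v), vecCode (vecFirst v)] :=
    Primrec.list_cons.comp (primrec_vecCode.comp primrec_vecDirection)
      (Primrec.list_cons.comp (primrec_vecCode.comp primrec_vecFirst) (Primrec.const []))
  refine Primrec.list_flatMap (Primrec.list_range.comp (Primrec.succ.comp (Primrec.nat_div.comp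
    (Primrec.nat_mul.comp Primrec.fst (primrec_num_toNat hr)) (primrec_den hr)))) ?_
  exact hl.comp (Primrec.snd.comp Primrec.fst)

/-! ### Estimates for the decomposition -/

theorem vecNormSq_nonneg (v : List (ℚ × ℚ)) : 0 ≤ vecNormSq v := by
  refine List.sum_nonneg fun x hx => ?_
  obtain ⟨c, -, rfl⟩ := List.mem_map.1 hx
  nlinarith [mul_self_nonneg c.1, mul_self_nonneg c.2]

theorem vecNormSq_cons (c : ℚ × ℚ) (v : List (ℚ × ℚ)) :
    vecNormSq (c :: v) = c.1 * c.1 + c.2 * c.2 + vecNormSq v := by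
  simp [vecNormSq]

theorem vecNormSq_ofFn {d : ℕ} (v : Fin d → ℚ × ℚ) :
    vecNormSq (List.ofFn v) = ∑ i, ((v i).1 ^ 2 + (v i).2 ^ 2) := by
  simp [vecNormSq, List.map_ofFn, List.sum_ofFn, sq]

/-- Let `r` be the squared norm, `a = approxNorm r` and x the real part of the first coordinate. The
equation r + 2Px + P² = (a - P)² is linear in P, which is why P is rational. Since |x| ≤ √r ≤ a/2,
the denominator 2(a + x) is at least a; so 0 ≤ P ≤ a, and a² ≤ 16r bounds both squares. -/
theorem vecShift_spec {c : ℚ × ℚ} {v : List (ℚ × ℚ)} (hr : 0 < vecNormSq (c :: v)) :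
    vecShift (c :: v) ^ 2 ≤ 16 * vecNormSq (c :: v) ∧
      vecResidue (c :: v) ^ 2 ≤ 16 * vecNormSq (c :: v) ∧
      vecNormSq ((c.1 + vecShift (c :: v), c.2) :: v) = vecResidue (c :: v) ^ 2 := by
  obtain ⟨h1, h2, h3⟩ := approxNorm_spec hr
  have hc : c.1 ^ 2 ≤ vecNormSq (c :: v) := by
    rw [vecNormSq_cons]
    nlinarith [vecNormSq_nonneg v, mul_self_nonneg c.2]
  have hn : ∀ x, vecNormSq ((x, c.2) :: v) = vecNormSq (c :: v) + x * x - c.1 * c.1 := fun x => by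
    rw [vecNormSq_cons, vecNormSq_cons]; ring
  rw [hn (c.1 + vecShift (c :: v))]
  have hac : approxNorm (vecNormSq (c :: v)) ≤ 2 * (approxNorm (vecNormSq (c :: v)) + c.1) := by
    have h6 := abs_le_of_sq_le_sq' (a := c.1) (b := approxNorm (vecNormSq (c :: v)) / 2)
      (by nlinarith) (by linarith)
    linarith [h6.1]
  have hP : vecShift (c :: v) * (2 * (approxNorm (vecNormSq (c :: v)) + c.1)) =
      approxNorm (vecNormSq (c :: v)) ^ 2 - vecNormSq (c :: v) := by
    rw [vecShift, List.headI_cons, div_mul_cancel₀ _ (by linarith), sq]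
  rw [vecResidue]
  generalize approxNorm (vecNormSq (c :: v)) = a at *
  generalize vecShift (c :: v) = P at *
  generalize vecNormSq (c :: v) = r at *
  have hP0 : 0 ≤ P := by
    by_contra hneg
    have := mul_neg_of_neg_of_pos (not_le.1 hneg) (h1.trans_le hac)
    nlinarith
  have hPa : P ≤ a := by
    have : P * a ≤ a * a := by nlinarith
    exact le_of_mul_le_mul_right this h1
  refine ⟨by nlinarith, by nlinarith, by linarith⟩

/-! ### Overlaps -/

/-- The complex vector with the given elementary coordinates. -/
def gaussVec {d : ℕ} (v : Fin d → ℚ × ℚ) : Fin d → ℂ := fun i => toC (v i)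

/-- The square of the absolute value of the inner product. -/
noncomputable def overlap {d : ℕ} (u : Fin d → ℂ) (v : Fin d → ℚ × ℚ) : ℝ :=
  Complex.normSq (star (gaussVec v) ⬝ᵥ u)

theorem overlap_nonneg {d : ℕ} (u : Fin d → ℂ) (v : Fin d → ℚ × ℚ) : 0 ≤ overlap u v :=
  Complex.normSq_nonneg _

/-- The overlap with `u` of the elementary state with a given code, and `0` for numbers that are
not codes of elementary states. -/
noncomputable def codeOverlap {d : ℕ} (u : Fin d → ℂ) : ℕ → ℝ≥0∞ :=
  Function.extend (ElementaryState.code (d := d)) (fun φ => ENNReal.ofReal (overlap u φ.1)) 0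

theorem codeOverlap_code {d : ℕ} (u : Fin d → ℂ) (φ : ElementaryState d) :
    codeOverlap u φ.code = ENNReal.ofReal (overlap u φ.1) :=
  ElementaryState.code_injective.extend_apply _ _ _

theorem codeOverlap_vecCode {d : ℕ} (u : Fin d → ℂ) (v : Fin d → ℚ × ℚ)
    (hv : vecNormSq (List.ofFn v) = 1) :
    codeOverlap u (vecCode (List.ofFn v)) = ENNReal.ofReal (overlap u v) := by
  rw [vecNormSq_ofFn] at hv
  rw [vecCode_ofFn]
  exact codeOverlap_code u ⟨v, hv⟩

theorem tsum_prob_mul_codeOverlap {d : ℕ} (u : Fin d → ℂ) (P : ℕ → ℝ≥0∞) :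
    ∑' x, P x * codeOverlap u x =
      ∑' φ : ElementaryState d, P φ.code * ENNReal.ofReal (overlap u φ.1) := by
  classical
  rw [← ElementaryState.code_injective.tsum_eq (f := fun x => P x * codeOverlap u x)]
  · exact tsum_congr fun φ => by rw [codeOverlap_code]
  · intro x hx
    by_contra hne
    exact hx (by simp [codeOverlap, Function.extend_apply' _ _ _ hne])

theorem toC_eq (z : ℚ × ℚ) : toC z = ((z.1 : ℚ) : ℂ) + ((z.2 : ℚ) : ℂ) * Complex.I := by
  apply Complex.ext <;> simp [toC]

theorem overlap_combination {d : ℕ} (u : Fin d → ℂ) {v a b : Fin d → ℚ × ℚ} {s P K : ℝ}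
    (h : gaussVec v = (s : ℂ) • gaussVec a + (P : ℂ) • gaussVec b) (hs : s ^ 2 ≤ K)
    (hP : P ^ 2 ≤ K) : overlap u v ≤ 2 * K * (overlap u a + overlap u b) := by
  rw [overlap, h, star_add, add_dotProduct, star_smul, star_smul, smul_dotProduct, smul_dotProduct]
  have h1 : ∀ x y : ℂ, Complex.normSq (x + y) ≤ 2 * (Complex.normSq x + Complex.normSq y) :=
    fun x y => by
      simp only [Complex.normSq_apply, Complex.add_re, Complex.add_im]
      nlinarith [sq_nonneg (x.re - y.re), sq_nonneg (x.im - y.im)]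
  refine (h1 _ _).trans ?_
  simp only [smul_eq_mul, Complex.normSq_mul, overlap]
  have h2 : ∀ x : ℝ, Complex.normSq (star (x : ℂ)) = x ^ 2 := fun x => by
    simp [Complex.normSq_apply, sq]
  rw [h2, h2]
  nlinarith [mul_le_mul_of_nonneg_right hs (Complex.normSq_nonneg (star (gaussVec a) ⬝ᵥ u)),
    mul_le_mul_of_nonneg_right hP (Complex.normSq_nonneg (star (gaussVec b) ⬝ᵥ u))]

theorem gaussVec_eq_zero {d : ℕ} {v : Fin d → ℚ × ℚ} (h : vecNormSq (List.ofFn v) = 0) :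
    gaussVec v = 0 := by
  rw [vecNormSq_ofFn, Finset.sum_eq_zero_iff_of_nonneg fun i _ => by positivity] at h
  funext i
  have hi := h i (Finset.mem_univ i)
  have h1 : (v i).1 = 0 := by nlinarith [sq_nonneg (v i).1, sq_nonneg (v i).2]
  have h2 : (v i).2 = 0 := by nlinarith [sq_nonneg (v i).1, sq_nonneg (v i).2]
  simp [gaussVec, toC_eq, h1, h2]

/-- This replaces the normalized block, which need not be elementary, by two elementary states. The
constant is 2 · 16: the 2 comes from |x + y|² ≤ 2(|x|² + |y|²), the 16 from `vecShift_spec`. -/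
theorem overlap_le {d : ℕ} (hd : d ≠ 0) (u : Fin d → ℂ) (v : Fin d → ℚ × ℚ) :
    ENNReal.ofReal (overlap u v) ≤ ENNReal.ofReal (32 * (vecNormSq (List.ofFn v) : ℝ)) *
      (codeOverlap u (vecCode (vecDirection (List.ofFn v))) +
        codeOverlap u (vecCode (vecFirst (List.ofFn v)))) := by
  obtain ⟨d, rfl⟩ := Nat.exists_eq_succ_of_ne_zero hd
  rcases (vecNormSq_nonneg (List.ofFn v)).eq_or_lt with hr | hr
  · simp [overlap, gaussVec_eq_zero hr.symm]
  have hv : List.ofFn v = v 0 :: List.ofFn fun i : Fin d => v i.succ := List.ofFn_succ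
  rw [hv] at hr ⊢
  obtain ⟨hP, hs, hn⟩ := vecShift_spec hr
  set w := List.ofFn fun i : Fin d => v i.succ with hw
  set P := vecShift (v 0 :: w) with hPd
  set s := vecResidue (v 0 :: w) with hsd
  set r := vecNormSq (v 0 :: w) with hrd
  let a : Fin (d + 1) → ℚ × ℚ := Fin.cons (((v 0).1 + P) / s, (v 0).2 / s)
    fun i => ((v i.succ).1 / s, (v i.succ).2 / s)
  let b : Fin (d + 1) → ℚ × ℚ := Fin.cons (1, 0) fun _ => (0, 0)
  have ha : vecDirection (v 0 :: w) = List.ofFn a := by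
    rw [List.ofFn_succ]
    rw [vecDirection, ← hsd, ← hPd]
    simp [a, hw, List.map_ofFn, Function.comp_def]
  have hb : vecFirst (v 0 :: w) = List.ofFn b := by
    rw [List.ofFn_succ]
    simp [vecFirst, b, hw, List.map_ofFn, Function.comp_def]
  have hbn : vecNormSq (List.ofFn b) = 1 := by
    rw [vecNormSq_ofFn, Fin.sum_univ_succ]
    simp [b]
  have hP' : (P : ℝ) ^ 2 ≤ 16 * (r : ℝ) := by exact_mod_cast hP
  have hs' : (s : ℝ) ^ 2 ≤ 16 * (r : ℝ) := by exact_mod_cast hs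
  rw [ha, hb, codeOverlap_vecCode u b hbn]
  let c : Fin (d + 1) → ℚ × ℚ := Fin.cons ((v 0).1 + P, (v 0).2) fun i : Fin d => v i.succ
  have hc : List.ofFn c = ((v 0).1 + P, (v 0).2) :: w := List.ofFn_succ
  have hvc : ∀ t : ℝ, ∀ c' : Fin (d + 1) → ℚ × ℚ, gaussVec c = (t : ℂ) • gaussVec c' →
      gaussVec v = (t : ℂ) • gaussVec c' + ((-P : ℝ) : ℂ) • gaussVec b := by
    intro t c' h
    rw [← h]
    funext i
    refine Fin.cases ?_ (fun j => ?_) i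
    · simp [gaussVec, toC_eq, c, b]
      ring
    · simp [gaussVec, toC_eq, c, b]
  have hP'' : (-P : ℝ) ^ 2 ≤ 16 * (r : ℝ) := by rwa [neg_sq]
  have hr' : (0 : ℝ) ≤ 32 * (r : ℝ) := by
    have : (0 : ℝ) < r := by exact_mod_cast hr
    positivity
  -- If the shifted vector is zero, then `v` is -P times the first basis vector. The term of
  -- `vecDirection`, whose entries are quotients by zero, is dropped.
  by_cases hs0 : s = 0
  · have hc0 : gaussVec c = 0 := by
      apply gaussVec_eq_zero
      rw [hc, hn, hs0]
      norm_num
    have h := overlap_combination u (K := 16 * (r : ℝ)) (hvc 0 c (by simp [hc0])) (by linarith) hP''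
    have hc1 : overlap u c = 0 := by simp [overlap, hc0]
    rw [hc1, zero_add] at h
    refine le_trans ?_ (mul_le_mul_right le_add_self _)
    rw [← ENNReal.ofReal_mul hr']
    exact ENNReal.ofReal_le_ofReal (by linarith)
  · have hca : gaussVec c = ((s : ℝ) : ℂ) • gaussVec a := by
      have : (s : ℂ) ≠ 0 := by exact_mod_cast hs0
      funext i
      refine Fin.cases ?_ (fun j => ?_) i <;>
      · simp [gaussVec, toC_eq, c, a]
        field_simp
    have han : vecNormSq (List.ofFn a) = 1 := by
      have h1 : vecNormSq (List.ofFn c) = s ^ 2 * vecNormSq (List.ofFn a) := by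
        rw [vecNormSq_ofFn, vecNormSq_ofFn, Finset.mul_sum]
        refine Finset.sum_congr rfl fun i _ => ?_
        refine Fin.cases ?_ (fun j => ?_) i <;>
        · simp [c, a]
          field_simp
      rw [hc, hn] at h1
      have : s ^ 2 ≠ 0 := by positivity
      exact (mul_left_cancel₀ this (by rw [mul_one]; exact h1)).symm
    rw [codeOverlap_vecCode u a han,
      ← ENNReal.ofReal_add (overlap_nonneg _ _) (overlap_nonneg _ _), ← ENNReal.ofReal_mul hr']
    refine ENNReal.ofReal_le_ofReal ?_
    have h := overlap_combination u (hvc s a hca) hs' hP''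
    linarith

/-! ### Sampling the blocks of an elementary state -/

theorem vecNormSq_mul_div (M : ℕ) (v : List (ℚ × ℚ)) :
    ((M * (vecNormSq v).num.toNat / (vecNormSq v).den : ℕ) : ℝ) ≤ M * (vecNormSq v : ℝ) ∧
    M * (vecNormSq v : ℝ) ≤
      ((M * (vecNormSq v).num.toNat / (vecNormSq v).den + 1 : ℕ) : ℝ) := by
  have hr := vecNormSq_nonneg v
  generalize vecNormSq v = r at *
  have hd : (0 : ℝ) < r.den := by exact_mod_cast r.den_pos
  have hnum : ((r.num.toNat : ℕ) : ℝ) = (r : ℝ) * r.den := by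
    have h1 : ((r.num.toNat : ℤ) : ℝ) = (r.num : ℝ) := by
      rw [Int.toNat_of_nonneg (Rat.num_nonneg.2 hr)]
    have h2 : (r : ℝ) * r.den = r.num := by exact_mod_cast Rat.mul_den_eq_num r
    rw [h2, ← h1]; rfl
  have hM : M * (r : ℝ) = ((M * r.num.toNat : ℕ) : ℝ) / (r.den : ℕ) := by
    push_cast
    rw [hnum]
    field_simp
  rw [hM]
  refine ⟨Nat.cast_div_le, ?_⟩
  rw [div_le_iff₀ hd]
  exact_mod_cast (Nat.lt_succ_iff.1 ((Nat.lt_mul_div_succ (M * r.num.toNat) r.den_pos).trans_le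
    (by rw [mul_comm]; exact Nat.le_succ _)))

theorem vecSamples_length (M : ℕ) (v : List (ℚ × ℚ)) :
    ((vecSamples M v).length : ℝ≥0∞) ≤ 2 * (ENNReal.ofReal (M * (vecNormSq v : ℝ)) + 1) := by
  have h1 : (vecSamples M v).length =
      2 * (M * (vecNormSq v).num.toNat / (vecNormSq v).den + 1) := by
    simp [vecSamples, List.length_flatMap, mul_comm]
  rw [h1]
  push_cast
  gcongr
  rw [← ENNReal.ofReal_natCast]
  exact ENNReal.ofReal_le_ofReal (vecNormSq_mul_div M v).1

theorem le_vecSamples_sum (M : ℕ) (v : List (ℚ × ℚ)) (F : ℕ → ℝ≥0∞) :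
    ENNReal.ofReal (M * (vecNormSq v : ℝ)) *
        (F (vecCode (vecDirection v)) + F (vecCode (vecFirst v))) ≤
      ((vecSamples M v).map F).sum := by
  have h0 : ∀ (c a b : ℕ), (((List.range c).flatMap fun _ => [a, b]).map F).sum =
      (c : ℝ≥0∞) * (F a + F b) := by
    intro c a b
    induction c with
    | zero => simp
    | succ c ih =>
      rw [List.range_succ, List.flatMap_append, List.map_append, List.sum_append, ih]
      simp
      ring
  rw [vecSamples, h0]
  gcongr
  rw [← ENNReal.ofReal_natCast]
  exact ENNReal.ofReal_le_ofReal (vecNormSq_mul_div M v).2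

/-- The coordinates of `ψ` whose index is `z` modulo `2 ^ m`. -/
def vecBlock (k m : ℕ) (ψ : List (ℚ × ℚ)) (z : ℕ) : List (ℚ × ℚ) :=
  (List.range (2 ^ k)).map fun i => ψ.getD (z + 2 ^ m * i) (0, 0)

/-- Codes of elementary states of `k` qubits the average of which dominates, up to a constant
factor, the partial trace over `m` qubits of the elementary state `ψ`. -/
def traceSamples (k m : ℕ) (ψ : List (ℚ × ℚ)) : List ℕ :=
  (List.range (2 ^ m)).flatMap fun z => vecSamples (2 ^ m) (vecBlock k m ψ z)

theorem computable_traceSamples :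
    Computable₂ fun y w : ℕ => traceSamples y.unpair.1 y.unpair.2.unpair.1 (vecDecode w) := by
  have hk : Primrec fun a : ℕ × ℕ => a.1.unpair.1 :=
    Primrec.fst.comp (Primrec.unpair.comp Primrec.fst)
  have hm : Primrec fun a : ℕ × ℕ => a.1.unpair.2.unpair.1 :=
    Primrec.fst.comp (Primrec.unpair.comp
      (Primrec.snd.comp (Primrec.unpair.comp Primrec.fst)))
  have hψ : Primrec fun a : ℕ × ℕ => vecDecode a.2 := primrec_vecDecode.comp Primrec.snd
  have hidx : Primrec fun a : ((ℕ × ℕ) × ℕ) × ℕ => a.1.2 + 2 ^ a.1.1.1.unpair.2.unpair.1 * a.2 :=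
    Primrec.nat_add.comp (Primrec.snd.comp Primrec.fst)
      (Primrec.nat_mul.comp (primrec_two_pow (hm.comp (Primrec.fst.comp Primrec.fst))) Primrec.snd)
  have hblock : Primrec fun a : (ℕ × ℕ) × ℕ =>
      vecBlock a.1.1.unpair.1 a.1.1.unpair.2.unpair.1 (vecDecode a.1.2) a.2 := by
    refine Primrec.list_map (Primrec.list_range.comp (primrec_two_pow (hk.comp Primrec.fst))) ?_
    exact (Primrec.list_getD (0, 0)).comp (hψ.comp (Primrec.fst.comp Primrec.fst)) hidx
  have hsamples : Primrec₂ fun (a : ℕ × ℕ) (z : ℕ) => vecSamples (2 ^ a.1.unpair.2.unpair.1)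
      (vecBlock a.1.unpair.1 a.1.unpair.2.unpair.1 (vecDecode a.2) z) :=
    primrec_vecSamples.comp (primrec_two_pow (hm.comp Primrec.fst)) hblock
  exact (Primrec.list_flatMap (Primrec.list_range.comp (primrec_two_pow hm)) hsamples).to_comp

/-- The basis vectors of `n` qubits as pairs of basis vectors. -/
def joinEquiv {m n : ℕ} (h : m ≤ n) : Fin (2 ^ (n - m)) × Fin (2 ^ m) ≃ Fin (2 ^ n) :=
  finProdFinEquiv.trans (finCongr (by rw [← pow_add, Nat.sub_add_cancel h]))

theorem joinEquiv_apply {m n : ℕ} (h : m ≤ n) (a : Fin (2 ^ (n - m)) × Fin (2 ^ m)) :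
    joinEquiv h a = joinIndex h a.1 a.2 := rfl

theorem joinIndex_val {m n : ℕ} (h : m ≤ n) (i : Fin (2 ^ (n - m))) (z : Fin (2 ^ m)) :
    (joinIndex h i z : ℕ) = z + 2 ^ m * i := rfl

theorem vecBlock_ofFn {m n : ℕ} (h : m ≤ n) (ψ : Fin (2 ^ n) → ℚ × ℚ) (z : Fin (2 ^ m)) :
    vecBlock (n - m) m (List.ofFn ψ) z = List.ofFn fun i => ψ (joinIndex h i z) := by
  apply List.ext_getElem
  · simp [vecBlock]
  · intro i h1 h2
    simp only [vecBlock, List.length_map, List.length_range] at h1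
    have h3 := (joinIndex h ⟨i, h1⟩ z).2
    rw [joinIndex_val] at h3
    simp only [vecBlock, List.getElem_map, List.getElem_range, List.getElem_ofFn]
    rw [List.getD_eq_getElem _ _ (by simpa using h3), List.getElem_ofFn]
    rfl

/-- The list contains each state of block z at least 2^m |ψ_z|² times, which yields 2^m times the
sum of overlaps on the left up to the factor 32. Its length is at most 4 · 2^m, so division by twice
the length costs 8 more: 32 · 8 = 2 ^ 8. -/
theorem sum_overlap_le {m n : ℕ} (h : m ≤ n) (u : Fin (2 ^ (n - m)) → ℂ)
    (ψ : ElementaryState (2 ^ n)) :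
    2⁻¹ ^ 8 * ∑ z, ENNReal.ofReal (overlap u fun i => ψ.1 (joinIndex h i z)) ≤
      ((traceSamples (n - m) m (List.ofFn ψ.1)).map (codeOverlap u)).sum /
        (2 * (traceSamples (n - m) m (List.ofFn ψ.1)).length) := by
  have hblock : ∀ z : Fin (2 ^ m), vecBlock (n - m) m (List.ofFn ψ.1) z =
    List.ofFn fun i => ψ.1 (joinIndex h i z) := vecBlock_ofFn h ψ.1
  have hsum : ∑ z : Fin (2 ^ m), (vecNormSq (vecBlock (n - m) m (List.ofFn ψ.1) z) : ℝ) = 1 := by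
    have h1 : ∑ z : Fin (2 ^ m), vecNormSq (vecBlock (n - m) m (List.ofFn ψ.1) z) = 1 := by
      simp only [hblock, vecNormSq_ofFn]
      refine Eq.trans ?_ ψ.2
      rw [← (joinEquiv h).sum_comp, Fintype.sum_prod_type_right]
      rfl
    exact_mod_cast h1
  have hS : ((traceSamples (n - m) m (List.ofFn ψ.1)).map (codeOverlap u)).sum =
      ∑ z : Fin (2 ^ m), ((vecSamples (2 ^ m) (vecBlock (n - m) m (List.ofFn ψ.1) z)).map
        (codeOverlap u)).sum := by
    rw [traceSamples, List.map_flatMap, List.flatMap_def, List.sum_flatten, List.map_map,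
      ← Finset.sum_range fun z => ((vecSamples (2 ^ m) (vecBlock (n - m) m (List.ofFn ψ.1) z)).map
        (codeOverlap u)).sum]
    rfl
  -- Rounding up adds at most 1 for each of the 2^m blocks, and the squared norms add up to 1; so
  -- there are at most 2^m + 2^m pairs of states.
  have hL : ((traceSamples (n - m) m (List.ofFn ψ.1)).length : ℝ≥0∞) ≤ 4 * 2 ^ m := by
    have h1 : (traceSamples (n - m) m (List.ofFn ψ.1)).length =
        ∑ z : Fin (2 ^ m), (vecSamples (2 ^ m) (vecBlock (n - m) m (List.ofFn ψ.1) z)).length := by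
      rw [traceSamples, List.length_flatMap, ← Finset.sum_range fun z =>
        (vecSamples (2 ^ m) (vecBlock (n - m) m (List.ofFn ψ.1) z)).length]
      rfl
    rw [h1]
    push_cast
    refine (Finset.sum_le_sum fun z _ => vecSamples_length _ _).trans ?_
    rw [← Finset.mul_sum, Finset.sum_add_distrib, ← ENNReal.ofReal_sum_of_nonneg, ← Finset.mul_sum,
      hsum]
    · simp [ENNReal.ofReal_pow]
      ring_nf
      exact le_rfl
    · intro z _
      have : (0 : ℝ) ≤ vecNormSq (vecBlock (n - m) m (List.ofFn ψ.1) z) := by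
        exact_mod_cast vecNormSq_nonneg _
      positivity
  have hL0 : (traceSamples (n - m) m (List.ofFn ψ.1)).length ≠ 0 := by
    refine (List.length_pos_of_mem (a := vecCode (vecDirection
      (vecBlock (n - m) m (List.ofFn ψ.1) 0))) ?_).ne'
    refine List.mem_flatMap.2 ⟨0, by simp, List.mem_flatMap.2 ⟨0, by simp, by simp⟩⟩
  have hA : (2 : ℝ≥0∞) ^ m * ∑ z, ENNReal.ofReal (overlap u fun i => ψ.1 (joinIndex h i z)) ≤
      32 * ((traceSamples (n - m) m (List.ofFn ψ.1)).map (codeOverlap u)).sum := by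
    rw [hS, Finset.mul_sum, Finset.mul_sum]
    refine Finset.sum_le_sum fun z _ => ?_
    have h1 : ENNReal.ofReal (overlap u fun i => ψ.1 (joinIndex h i z)) ≤
        ENNReal.ofReal (32 * (vecNormSq (vecBlock (n - m) m (List.ofFn ψ.1) z) : ℝ)) *
        (codeOverlap u (vecCode (vecDirection (vecBlock (n - m) m (List.ofFn ψ.1) z))) +
          codeOverlap u (vecCode (vecFirst (vecBlock (n - m) m (List.ofFn ψ.1) z)))) := by
      rw [hblock]
      exact overlap_le (by positivity) u _
    refine (mul_le_mul_right h1 _).trans ?_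
    refine le_trans (le_of_eq ?_) (mul_le_mul_right (le_vecSamples_sum _ _ _) _)
    rw [ENNReal.ofReal_mul (by norm_num), ENNReal.ofReal_mul (by positivity)]
    simp [ENNReal.ofReal_pow]
    ring
  rw [ENNReal.le_div_iff_mul_le (Or.inl (by simpa using hL0))
    (Or.inl (ENNReal.mul_ne_top (by simp) (by simp)))]
  calc _ ≤ 2⁻¹ ^ 8 * (∑ z, ENNReal.ofReal (overlap u fun i => ψ.1 (joinIndex h i z))) *
        (2 * (4 * 2 ^ m)) := by gcongr
    _ = 2⁻¹ ^ 8 * 2 ^ 3 * (2 ^ m * ∑ z, ENNReal.ofReal (overlap u fun i =>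
        ψ.1 (joinIndex h i z))) := by ring
    _ ≤ 2⁻¹ ^ 8 * 2 ^ 3 * (32 * ((traceSamples (n - m) m (List.ofFn ψ.1)).map
        (codeOverlap u)).sum) := by gcongr
    _ = (2⁻¹ * 2) ^ 8 * ((traceSamples (n - m) m (List.ofFn ψ.1)).map (codeOverlap u)).sum := by
      ring
    _ = _ := by rw [ENNReal.inv_mul_cancel (by simp) (by simp), one_pow, one_mul]

/-- The auxiliary input (n - m, (m, n)) contains n, so the sampler can simulate `U` with auxiliary
input (n, (m, n)), decode ψ from the output and sample from `traceSamples`. Words that are not codes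
of elementary states of n qubits are left out of the sum. -/
theorem Machine.IsUniversal.tsum_overlap_le {U : Machine} (hU : U.IsUniversal) :
    ∃ N : ℕ, ∀ (m n : ℕ) (h : m ≤ n) (u : Fin (2 ^ (n - m)) → ℂ),
      2⁻¹ ^ N * ∑' ψ : ElementaryState (2 ^ n), U.prob (Nat.pair n (Nat.pair m n)) ψ.code *
          ∑ z, ENNReal.ofReal (overlap u fun i => ψ.1 (joinIndex h i z)) ≤
        ∑' φ : ElementaryState (2 ^ (n - m)), U.prob (Nat.pair (n - m) (Nat.pair m n)) φ.code *
          ENNReal.ofReal (overlap u φ.1) := by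
  have hh : Computable fun y : ℕ => Nat.pair y.unpair.2.unpair.2 y.unpair.2 := by
    have h1 : Primrec fun y : ℕ => y.unpair.2 := Primrec.snd.comp Primrec.unpair
    exact (Primrec₂.natPair.comp (h1.comp h1) h1).to_comp
  obtain ⟨N, hN⟩ := hU.prob_sample_le hh computable_traceSamples
  refine ⟨N + 8, fun m n h u => ?_⟩
  have h1 := hN (Nat.pair (n - m) (Nat.pair m n)) (codeOverlap u)
  rw [tsum_prob_mul_codeOverlap] at h1
  simp only [Nat.unpair_pair] at h1
  refine le_trans ?_ h1
  rw [pow_add, mul_assoc]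
  gcongr
  rw [← ENNReal.tsum_mul_left]
  refine le_trans (ENNReal.tsum_le_tsum fun ψ => ?_)
    (ENNReal.tsum_comp_le_tsum_of_injective ElementaryState.code_injective _)
  have h2 : vecDecode ψ.code = List.ofFn ψ.1 := by
    rw [ElementaryState.code, ← vecCode_ofFn, vecDecode_vecCode]
  rw [mul_left_comm, h2]
  gcongr
  exact sum_overlap_le h u ψ

/-! ### Positive semidefinite matrices -/

theorem summable_toReal_smul {ι κ : Type*} {c : κ → ℝ≥0∞} {T : κ → Matrix ι ι ℂ}
    (hc : ∑' k, c k ≠ ∞) {K : ℝ} (hT : ∀ k i j, ‖T k i j‖ ≤ K) :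
    Summable fun k => (c k).toReal • T k := by
  refine Pi.summable.2 fun i => Pi.summable.2 fun j => ?_
  refine Summable.of_norm_bounded ((ENNReal.summable_toReal hc).mul_right K) fun k => ?_
  rw [Matrix.smul_apply, norm_smul, Real.norm_of_nonneg ENNReal.toReal_nonneg]
  exact mul_le_mul_of_nonneg_left (hT k i j) ENNReal.toReal_nonneg

section

variable {ι : Type*} [Fintype ι]

open scoped MatrixOrder in
theorem exists_eq_conjTranspose_mul_self {T : Matrix ι ι ℂ} (hT : T.PosSemidef) :
    ∃ B : Matrix ι ι ℂ, T = Bᴴ * B := by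
  classical
  exact CStarAlgebra.nonneg_iff_eq_star_mul_self.mp hT.nonneg

theorem trace_mul_re_nonneg {T S : Matrix ι ι ℂ} (hT : T.PosSemidef) (hS : S.PosSemidef) :
    0 ≤ (Matrix.trace (T * S)).re := by
  obtain ⟨B, rfl⟩ := exists_eq_conjTranspose_mul_self hT
  rw [Matrix.mul_assoc, Matrix.trace_mul_comm]
  exact (Complex.le_def.1 (hS.mul_mul_conjTranspose_same B).trace_nonneg).1

/-- Entries of Bᴴ B are inner products of columns of B, and its diagonal consists of their squared
norms, which the trace bounds. -/
theorem norm_entry_le_trace {T : Matrix ι ι ℂ} (hT : T.PosSemidef) (i j : ι) :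
    ‖T i j‖ ≤ (Matrix.trace T).re := by
  obtain ⟨B, rfl⟩ := exists_eq_conjTranspose_mul_self hT
  have hdiag : ∀ i, ((Bᴴ * B) i i).re = ∑ k, ‖B k i‖ ^ 2 := fun i => by
    rw [Matrix.mul_apply, Complex.re_sum]
    refine Finset.sum_congr rfl fun k _ => ?_
    rw [Matrix.conjTranspose_apply, Complex.star_def, ← Complex.normSq_eq_conj_mul_self,
      Complex.ofReal_re, Complex.normSq_eq_norm_sq]
  have hle : ∀ i, ((Bᴴ * B) i i).re ≤ (Matrix.trace (Bᴴ * B)).re := fun i => by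
    rw [Matrix.trace, Complex.re_sum]
    refine Finset.single_le_sum (f := fun i => ((Bᴴ * B) i i).re) (fun k _ => ?_)
      (Finset.mem_univ i)
    simp only [hdiag]
    positivity
  have h1 := hle i
  have h2 := hle j
  rw [hdiag] at h1 h2
  calc ‖(Bᴴ * B) i j‖ ≤ ∑ k, ‖B k i‖ * ‖B k j‖ := by
        rw [Matrix.mul_apply]
        refine (norm_sum_le _ _).trans (le_of_eq (Finset.sum_congr rfl fun k _ => ?_))
        rw [norm_mul, Matrix.conjTranspose_apply, norm_star]
    _ ≤ ∑ k, (‖B k i‖ ^ 2 + ‖B k j‖ ^ 2) / 2 := by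
        refine Finset.sum_le_sum fun k _ => ?_
        nlinarith [sq_nonneg (‖B k i‖ - ‖B k j‖)]
    _ = ((∑ k, ‖B k i‖ ^ 2) + ∑ k, ‖B k j‖ ^ 2) / 2 := by
        rw [← Finset.sum_add_distrib, Finset.sum_div]
    _ ≤ _ := by linarith

/-- The map `T ↦ Re Tr (T S)`. -/
def reTrace (S : Matrix ι ι ℂ) : Matrix ι ι ℂ →ₗ[ℝ] ℝ where
  toFun T := (Matrix.trace (T * S)).re
  map_add' A B := by rw [Matrix.add_mul, Matrix.trace_add, Complex.add_re]
  map_smul' c A := by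
    rw [Matrix.smul_mul, Matrix.trace_smul, Complex.smul_re, RingHom.id_apply]

theorem reTrace_apply (S T : Matrix ι ι ℂ) : reTrace S T = (Matrix.trace (T * S)).re := rfl

theorem reTrace_nonneg {T S : Matrix ι ι ℂ} (hT : T.PosSemidef) (hS : S.PosSemidef) :
    0 ≤ reTrace S T :=
  trace_mul_re_nonneg hT hS

theorem continuous_matrix_functional (L : Matrix ι ι ℂ →ₗ[ℝ] ℝ) : Continuous L :=
  LinearMap.continuous_of_finiteDimensional L

/-- The projection on a vector, up to normalization. -/
def ketBra (v : ι → ℂ) : Matrix ι ι ℂ := Matrix.vecMulVec v (star v)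

theorem posSemidef_ketBra (v : ι → ℂ) : (ketBra v).PosSemidef :=
  Matrix.posSemidef_vecMulVec_self_star v

theorem trace_mul_ketBra (T : Matrix ι ι ℂ) (v : ι → ℂ) :
    Matrix.trace (T * ketBra v) = star v ⬝ᵥ T *ᵥ v := by
  rw [ketBra, Matrix.mul_vecMulVec, Matrix.trace_vecMulVec, dotProduct_comm]

/-- This reduces Loewner inequalities to scalar inequalities, one vector at a time. -/
theorem posSemidef_of_reTrace_nonneg {T : Matrix ι ι ℂ} (hT : T.IsHermitian)
    (h : ∀ v, 0 ≤ reTrace (ketBra v) T) : T.PosSemidef := by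
  refine Matrix.PosSemidef.of_dotProduct_mulVec_nonneg hT fun v => Complex.le_def.2 ⟨?_, ?_⟩
  · have := h v
    rwa [reTrace_apply, trace_mul_ketBra] at this
  · exact (hT.im_star_dotProduct_mulVec_self v).symm

theorem posSemidef_of_tendsto {κ : Type*} {l : Filter κ} [l.NeBot] {T : κ → Matrix ι ι ℂ}
    {M : Matrix ι ι ℂ} (hT : ∀ k, (T k).PosSemidef) (h : Filter.Tendsto T l (𝓝 M)) :
    M.PosSemidef := by
  refine posSemidef_of_reTrace_nonneg ?_ fun v => ?_
  · refine tendsto_nhds_unique ?_ h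
    have h2 : Filter.Tendsto (fun k => (T k)ᴴ) l (𝓝 Mᴴ) :=
      (continuous_id.matrix_conjTranspose.tendsto M).comp h
    exact h2.congr fun k => (hT k).1
  · exact ge_of_tendsto' (((continuous_matrix_functional _).tendsto M).comp h)
      fun k => trace_mul_re_nonneg (hT k) (posSemidef_ketBra v)

/-! ### Weighted sums of matrices -/

variable {κ : Type*} {c : κ → ℝ≥0∞} {T : κ → Matrix ι ι ℂ}

theorem ofReal_functional_tsum (h : Summable fun k => (c k).toReal • T k) (hc : ∀ k, c k ≠ ∞)
    (L : Matrix ι ι ℂ →ₗ[ℝ] ℝ) (hL : ∀ k, 0 ≤ L (T k)) :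
    ENNReal.ofReal (L (∑' k, (c k).toReal • T k)) = ∑' k, c k * ENNReal.ofReal (L (T k)) := by
  have h1 := h.hasSum.map L (continuous_matrix_functional L)
  rw [← h1.tsum_eq, ENNReal.ofReal_tsum_of_nonneg _ h1.summable]
  · refine tsum_congr fun k => ?_
    simp only [Function.comp_apply, map_smul, smul_eq_mul]
    rw [ENNReal.ofReal_mul ENNReal.toReal_nonneg, ENNReal.ofReal_toReal (hc k)]
  · intro k
    simp only [Function.comp_apply, map_smul, smul_eq_mul]
    exact mul_nonneg ENNReal.toReal_nonneg (hL k)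

theorem posSemidef_tsum (h : Summable fun k => (c k).toReal • T k) (hT : ∀ k, (T k).PosSemidef) :
    (∑' k, (c k).toReal • T k).PosSemidef :=
  posSemidef_of_tendsto (fun s => Matrix.posSemidef_sum s fun k _ =>
    (hT k).smul ENNReal.toReal_nonneg) h.hasSum

end

/-! ### Tensor products -/

section

variable {d : ℕ}

theorem tensor_apply (A B : Matrix (Fin d) (Fin d) ℂ) (a b : Fin (d * d)) :
    tensor A B a b = A (finProdFinEquiv.symm a).1 (finProdFinEquiv.symm b).1 *
      B (finProdFinEquiv.symm a).2 (finProdFinEquiv.symm b).2 := rfl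

theorem posSemidef_tensor {A B : Matrix (Fin d) (Fin d) ℂ} (hA : A.PosSemidef)
    (hB : B.PosSemidef) : (tensor A B).PosSemidef :=
  (hA.kronecker hB).submatrix _

/-- Y ⊗ Y - X ⊗ X = (Y - X) ⊗ Y + X ⊗ (Y - X), a sum of products of positive semidefinite matrices.
-/
theorem posSemidef_tensor_sub {X Y : Matrix (Fin d) (Fin d) ℂ} (hX : X.PosSemidef)
    (hY : Y.PosSemidef) (h : (Y - X).PosSemidef) : (tensor Y Y - tensor X X).PosSemidef := by
  have : tensor Y Y - tensor X X = tensor (Y - X) Y + tensor X (Y - X) := by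
    ext a b
    simp only [Matrix.sub_apply, Matrix.add_apply, tensor_apply]
    ring
  rw [this]
  exact (posSemidef_tensor h hY).add (posSemidef_tensor hX h)

theorem tensor_smul (c : ℝ) (A B : Matrix (Fin d) (Fin d) ℂ) :
    tensor (c • A) (c • B) = (c ^ 2) • tensor A B := by
  ext a b
  simp only [Matrix.smul_apply, tensor_apply, Complex.real_smul]
  push_cast
  ring

theorem tensor_one : tensor (1 : Matrix (Fin d) (Fin d) ℂ) 1 = 1 := by
  simp [tensor]

theorem reTrace_mono {ι : Type*} [Fintype ι] {T X Y : Matrix ι ι ℂ} (hT : T.PosSemidef)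
    (h : (Y - X).PosSemidef) : reTrace X T ≤ reTrace Y T := by
  have := trace_mul_re_nonneg hT h
  rw [Matrix.mul_sub, Matrix.trace_sub, Complex.sub_re] at this
  simp only [reTrace_apply]
  linarith

theorem reTrace_smul {ι : Type*} [Fintype ι] (c : ℝ) (T X : Matrix ι ι ℂ) :
    reTrace (c • X) T = c * reTrace X T := by
  rw [reTrace_apply, Matrix.mul_smul, Matrix.trace_smul, Complex.smul_re]
  rfl

end

/-! ### The universal semi-density matrix -/

theorem proj_eq_ketBra {d : ℕ} (φ : ElementaryState d) : φ.proj = ketBra (gaussVec φ.1) := rfl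

theorem trace_ketBra_mul_ketBra {ι : Type*} [Fintype ι] (u v : ι → ℂ) :
    reTrace (ketBra v) (ketBra u) = Complex.normSq (star u ⬝ᵥ v) := by
  rw [reTrace_apply, trace_mul_ketBra, ketBra, Matrix.vecMulVec_mulVec, dotProduct_smul,
    op_smul_eq_mul]
  have : star v ⬝ᵥ u = star (star u ⬝ᵥ v) := by
    rw [Matrix.star_dotProduct]
  rw [this, Complex.star_def, ← Complex.normSq_eq_conj_mul_self, Complex.ofReal_re]

theorem reTrace_proj {d : ℕ} (u : Fin d → ℂ) (φ : ElementaryState d) :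
    reTrace (ketBra u) φ.proj = overlap u φ.1 := by
  rw [proj_eq_ketBra, trace_ketBra_mul_ketBra]; rfl

theorem trace_proj {d : ℕ} (φ : ElementaryState d) : (Matrix.trace φ.proj).re = 1 := by
  rw [proj_eq_ketBra, ketBra, Matrix.trace_vecMulVec, dotProduct, Complex.re_sum]
  have h : ∑ i, (((φ.1 i).1 ^ 2 + (φ.1 i).2 ^ 2 : ℚ) : ℝ) = 1 := by exact_mod_cast φ.2
  rw [← h]
  refine Finset.sum_congr rfl fun i _ => ?_
  simp [gaussVec, toC, sq]

theorem posSemidef_proj {d : ℕ} (φ : ElementaryState d) : φ.proj.PosSemidef :=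
  posSemidef_ketBra _

variable {U : Machine}

theorem tsum_prob_code_le_one (y d : ℕ) : ∑' φ : ElementaryState d, U.prob y φ.code ≤ 1 :=
  (ENNReal.tsum_comp_le_tsum_of_injective ElementaryState.code_injective _).trans
    (Machine.tsum_prob_le_one y)

theorem summable_universalMatrix (x k : ℕ) :
    Summable fun φ : ElementaryState (2 ^ k) => (U.prob (Nat.pair k x) φ.code).toReal • φ.proj :=
  summable_toReal_smul (K := 1)
    ((tsum_prob_code_le_one _ _).trans_lt ENNReal.one_lt_top).ne
    fun φ i j => (norm_entry_le_trace (posSemidef_proj φ) i j).trans (trace_proj φ).le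

theorem posSemidef_universalMatrix (x k : ℕ) : (universalMatrix U x k).PosSemidef :=
  posSemidef_tsum (summable_universalMatrix x k) posSemidef_proj

theorem ofReal_reTrace_universalMatrix (x k : ℕ) (u : Fin (2 ^ k) → ℂ) :
    ENNReal.ofReal (reTrace (ketBra u) (universalMatrix U x k)) =
      ∑' φ : ElementaryState (2 ^ k), U.prob (Nat.pair k x) φ.code *
        ENNReal.ofReal (overlap u φ.1) := by
  rw [universalMatrix, ofReal_functional_tsum (summable_universalMatrix x k)
    (fun φ => Machine.prob_ne_top _ _)]
  · exact tsum_congr fun φ => by rw [reTrace_proj]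
  · intro φ
    rw [reTrace_proj]
    exact overlap_nonneg _ _

/-- A basis vector as an elementary state. -/
def basisState {d : ℕ} (i : Fin d) : ElementaryState d :=
  ⟨Pi.single i (1, 0), by
    rw [Finset.sum_eq_single i]
    · simp
    · intro j _ hj; simp [hj]
    · simp⟩

theorem overlap_basisState {d : ℕ} (u : Fin d → ℂ) (i : Fin d) :
    overlap u (basisState i).1 = Complex.normSq (u i) := by
  have : gaussVec (basisState i).1 = Pi.single i 1 := by
    funext j
    by_cases h : j = i
    · subst h; simp [gaussVec, basisState, toC_eq]
    · simp [gaussVec, basisState, toC_eq, h]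
  rw [overlap, this, ← Pi.single_star, star_one, single_one_dotProduct]

/-- Each of the finitely many basis states has positive universal probability; `c` is the least of
these. It may depend on `x` and `k`, since it serves only to prove convergence. -/
theorem Machine.IsUniversal.exists_smul_one_le (hU : U.IsUniversal) (x k : ℕ) :
    ∃ c : ℝ, 0 < c ∧ (universalMatrix U x k - c • 1).PosSemidef := by
  have hpos : ∀ i : Fin (2 ^ k), 0 < (U.prob (Nat.pair k x) (basisState i).code).toReal := fun i =>
    ENNReal.toReal_pos (hU.prob_pos _ _).ne' (prob_ne_top _ _)
  obtain ⟨i₀, hi₀⟩ := Finite.exists_min fun i : Fin (2 ^ k) =>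
    (U.prob (Nat.pair k x) (basisState i).code).toReal
  refine ⟨_, hpos i₀, posSemidef_of_reTrace_nonneg ?_ fun u => ?_⟩
  · refine (posSemidef_universalMatrix x k).1.sub ?_
    exact (Matrix.PosSemidef.one.smul (hpos i₀).le).1
  · rw [map_sub, map_smul, sub_nonneg]
    have hμ : 0 ≤ reTrace (ketBra u) (universalMatrix U x k) :=
      trace_mul_re_nonneg (posSemidef_universalMatrix x k) (posSemidef_ketBra u)
    have h1 : reTrace (ketBra u) 1 = ∑ i, Complex.normSq (u i) := by
      rw [reTrace_apply, trace_mul_ketBra, Matrix.one_mulVec, dotProduct, Complex.re_sum]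
      refine Finset.sum_congr rfl fun i _ => ?_
      simp [Complex.normSq_apply]
    rw [h1, smul_eq_mul, Finset.mul_sum, ← ENNReal.ofReal_le_ofReal_iff hμ,
      ofReal_reTrace_universalMatrix, ENNReal.ofReal_sum_of_nonneg fun i _ =>
        mul_nonneg (hpos i₀).le (Complex.normSq_nonneg _)]
    have hinj : Function.Injective (basisState (d := 2 ^ k)) := fun i j h => by
      by_contra hne
      have h2 := congrFun (congrArg (fun φ : ElementaryState (2 ^ k) => φ.1) h) i
      simp [basisState, hne] at h2
    refine le_trans ?_ (ENNReal.tsum_comp_le_tsum_of_injective hinj _)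
    rw [tsum_fintype]
    refine Finset.sum_le_sum fun i _ => ?_
    rw [overlap_basisState, ENNReal.ofReal_mul (hpos i₀).le]
    gcongr
    rw [← ENNReal.ofReal_toReal (Machine.prob_ne_top _ (basisState i).code)]
    exact ENNReal.ofReal_le_ofReal (hi₀ i)

/-! ### Partial traces -/

theorem partialTrace_eq_sum {m n : ℕ} (h : m ≤ n) (σ : Matrix (Fin (2 ^ n)) (Fin (2 ^ n)) ℂ) :
    partialTrace h σ = ∑ z, σ.submatrix (fun i => joinIndex h i z) fun i => joinIndex h i z := by
  ext i j
  rw [Matrix.sum_apply]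
  rfl

theorem posSemidef_partialTrace {m n : ℕ} (h : m ≤ n) {σ : Matrix (Fin (2 ^ n)) (Fin (2 ^ n)) ℂ}
    (hσ : σ.PosSemidef) : (partialTrace h σ).PosSemidef := by
  rw [partialTrace_eq_sum]
  exact Matrix.posSemidef_sum _ fun z _ => hσ.submatrix _

/-- The partial trace as a linear map. -/
noncomputable def partialTraceLinear {m n : ℕ} (h : m ≤ n) :
    Matrix (Fin (2 ^ n)) (Fin (2 ^ n)) ℂ →ₗ[ℝ] Matrix (Fin (2 ^ (n - m))) (Fin (2 ^ (n - m))) ℂ where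
  toFun := partialTrace h
  map_add' A B := by ext i j; simp [partialTrace, Finset.sum_add_distrib]
  map_smul' c A := by ext i j; simp [partialTrace, Finset.mul_sum]

theorem reTrace_partialTrace_proj {m n : ℕ} (h : m ≤ n) (u : Fin (2 ^ (n - m)) → ℂ)
    (ψ : ElementaryState (2 ^ n)) :
    reTrace (ketBra u) (partialTrace h ψ.proj) =
      ∑ z, overlap u fun i => ψ.1 (joinIndex h i z) := by
  rw [partialTrace_eq_sum, map_sum]
  refine Finset.sum_congr rfl fun z _ => ?_
  rw [overlap, ← trace_ketBra_mul_ketBra]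
  rfl

theorem ofReal_reTrace_partialTrace_universalMatrix {m n : ℕ} (h : m ≤ n) (x : ℕ)
    (u : Fin (2 ^ (n - m)) → ℂ) :
    ENNReal.ofReal (reTrace (ketBra u) (partialTrace h (universalMatrix U x n))) =
      ∑' ψ : ElementaryState (2 ^ n), U.prob (Nat.pair n x) ψ.code *
        ∑ z, ENNReal.ofReal (overlap u fun i => ψ.1 (joinIndex h i z)) := by
  have hL : ∀ ψ : ElementaryState (2 ^ n),
      (reTrace (ketBra u) ∘ₗ partialTraceLinear h) ψ.proj =
        ∑ z, overlap u fun i => ψ.1 (joinIndex h i z) := reTrace_partialTrace_proj h u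
  have h1 := ofReal_functional_tsum (summable_universalMatrix (U := U) x n)
    (fun φ => Machine.prob_ne_top _ _) (reTrace (ketBra u) ∘ₗ partialTraceLinear h) fun ψ => by
      rw [hL]
      exact Finset.sum_nonneg fun z _ => overlap_nonneg _ _
  refine h1.trans (tsum_congr fun ψ => ?_)
  rw [hL, ENNReal.ofReal_sum_of_nonneg fun z _ => overlap_nonneg _ _]

/-- The partial trace of the universal matrix is dominated by the universal matrix. -/
theorem Machine.IsUniversal.partialTrace_universalMatrix_le (hU : U.IsUniversal) :
    ∃ N : ℕ, ∀ (m n : ℕ) (h : m ≤ n),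
      ((2 : ℝ) ^ N • universalMatrix U (Nat.pair m n) (n - m) -
        partialTrace h (universalMatrix U (Nat.pair m n) n)).PosSemidef := by
  obtain ⟨N, hN⟩ := hU.tsum_overlap_le
  refine ⟨N, fun m n h => ?_⟩
  have hp := posSemidef_partialTrace h (posSemidef_universalMatrix (U := U) (Nat.pair m n) n)
  have hk := posSemidef_universalMatrix (U := U) (Nat.pair m n) (n - m)
  refine posSemidef_of_reTrace_nonneg ?_ fun u => ?_
  · exact (hk.smul (by positivity : (0 : ℝ) ≤ 2 ^ N)).1.sub hp.1
  · have h1 := hN m n h u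
    rw [← ofReal_reTrace_universalMatrix, ← ofReal_reTrace_partialTrace_universalMatrix] at h1
    -- The inequality between sums in `ℝ≥0∞` is brought back to the real quadratic forms at `u`.
    have h2 : (2⁻¹ : ℝ≥0∞) ^ N = ENNReal.ofReal (2⁻¹ ^ N) := by
      rw [ENNReal.ofReal_pow (by positivity), ENNReal.ofReal_inv_of_pos (by norm_num)]
      simp
    rw [h2, ← ENNReal.ofReal_mul (by positivity), ENNReal.ofReal_le_ofReal_iff
      (reTrace_nonneg hk (posSemidef_ketBra u))] at h1
    rw [map_sub, map_smul, smul_eq_mul, sub_nonneg]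
    calc _ = 2 ^ N * (2⁻¹ ^ N * reTrace (ketBra u)
          (partialTrace h (universalMatrix U (Nat.pair m n) n))) := by
          rw [← mul_assoc, ← mul_pow]; norm_num
      _ ≤ _ := by gcongr

/-! ### Extending a test by the identity -/

/-- A pair of basis vectors of `n` qubits as the pair of the first `n - m` qubits of both and the
pair of the last `m` qubits of both. -/
def splitEquiv {m n : ℕ} (h : m ≤ n) :
    Fin (2 ^ n * 2 ^ n) ≃ Fin (2 ^ (n - m) * 2 ^ (n - m)) × (Fin (2 ^ m) × Fin (2 ^ m)) :=
  (finProdFinEquiv.symm.trans ((joinEquiv h).symm.prodCongr (joinEquiv h).symm)).trans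
    ((Equiv.prodProdProdComm _ _ _ _).trans (finProdFinEquiv.prodCongr (Equiv.refl _)))

/-- The matrix on two systems of `n` qubits that acts as `T` on the first `n - m` qubits of both
and as the identity on the others. -/
def extendMatrix {m n : ℕ} (h : m ≤ n)
    (T : Matrix (Fin (2 ^ (n - m) * 2 ^ (n - m))) (Fin (2 ^ (n - m) * 2 ^ (n - m))) ℂ) :
    Matrix (Fin (2 ^ n * 2 ^ n)) (Fin (2 ^ n * 2 ^ n)) ℂ :=
  (T ⊗ₖ (1 : Matrix (Fin (2 ^ m) × Fin (2 ^ m)) (Fin (2 ^ m) × Fin (2 ^ m)) ℂ)).submatrix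
    (splitEquiv h) (splitEquiv h)

section

variable {m n : ℕ} (h : m ≤ n)
  {T : Matrix (Fin (2 ^ (n - m) * 2 ^ (n - m))) (Fin (2 ^ (n - m) * 2 ^ (n - m))) ℂ}

theorem extendMatrix_apply (a b : Fin (2 ^ n * 2 ^ n)) : extendMatrix h T a b =
    if (splitEquiv h a).2 = (splitEquiv h b).2 then T (splitEquiv h a).1 (splitEquiv h b).1
    else 0 := by
  rw [extendMatrix, Matrix.submatrix_apply, Matrix.kroneckerMap_apply, Matrix.one_apply]
  simp

theorem posSemidef_extendMatrix (hT : T.PosSemidef) : (extendMatrix h T).PosSemidef :=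
  (hT.kronecker Matrix.PosSemidef.one).submatrix _

theorem extendMatrix_injective : Function.Injective (extendMatrix h) := fun T T' he => by
  ext p q
  have := congrFun (congrFun he ((splitEquiv h).symm (p, 0))) ((splitEquiv h).symm (q, 0))
  simpa [extendMatrix_apply] using this

theorem extendMatrix_sub (T T' : Matrix (Fin (2 ^ (n - m) * 2 ^ (n - m))) (Fin (2 ^ (n - m) * 2 ^ (n - m))) ℂ) :
    extendMatrix h (T - T') = extendMatrix h T - extendMatrix h T' := by
  ext a b
  simp only [extendMatrix_apply, Matrix.sub_apply]
  split_ifs <;> simp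

theorem continuous_extendMatrix : Continuous (extendMatrix h) := by
  refine continuous_matrix fun a b => ?_
  simp only [extendMatrix_apply]
  split_ifs
  · exact continuous_id.matrix_elem _ _
  · exact continuous_const

theorem extendMatrix_tensor (A B : Matrix (Fin (2 ^ (n - m))) (Fin (2 ^ (n - m))) ℂ) :
    ∃ A' B' : Matrix (Fin (2 ^ n)) (Fin (2 ^ n)) ℂ,
      extendMatrix h (tensor A B) = tensor A' B' := by
  refine ⟨(A ⊗ₖ (1 : Matrix (Fin (2 ^ m)) (Fin (2 ^ m)) ℂ)).submatrix (joinEquiv h).symm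
    (joinEquiv h).symm, (B ⊗ₖ (1 : Matrix (Fin (2 ^ m)) (Fin (2 ^ m)) ℂ)).submatrix
    (joinEquiv h).symm (joinEquiv h).symm, ?_⟩
  ext a b
  rw [extendMatrix_apply, tensor_apply, tensor_apply]
  simp only [Matrix.submatrix_apply, Matrix.kroneckerMap_apply, Matrix.one_apply, splitEquiv,
    Equiv.trans_apply, Equiv.prodCongr_apply, Prod.map, Equiv.prodProdProdComm_apply,
    Equiv.symm_apply_apply, Equiv.refl_apply, Prod.mk.injEq]
  split_ifs <;> simp_all

/-- Adjointness of extension and partial trace: the identity on the last qubits forces their row and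
column indices to agree, and the sum over the common index is the partial trace. -/
theorem trace_extendMatrix_mul (σ ρ : Matrix (Fin (2 ^ n)) (Fin (2 ^ n)) ℂ) :
    Matrix.trace (extendMatrix h T * tensor σ ρ) =
      Matrix.trace (T * tensor (partialTrace h σ) (partialTrace h ρ)) := by
  have h1 : ∀ p q : Fin (2 ^ (n - m) * 2 ^ (n - m)),
      tensor (partialTrace h σ) (partialTrace h ρ) p q =
        ∑ z, tensor σ ρ ((splitEquiv h).symm (p, z)) ((splitEquiv h).symm (q, z)) := by
    intro p q
    rw [tensor_apply, partialTrace, partialTrace, Matrix.of_apply, Matrix.of_apply,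
      Finset.sum_mul_sum, Fintype.sum_prod_type]
    refine Finset.sum_congr rfl fun z _ => Finset.sum_congr rfl fun z' _ => ?_
    rw [tensor_apply]
    simp [splitEquiv, joinEquiv_apply]
  simp only [Matrix.trace, Matrix.diag_apply, Matrix.mul_apply]
  rw [← Equiv.sum_comp (splitEquiv h).symm fun a => ∑ b, extendMatrix h T a b * tensor σ ρ b a,
    Fintype.sum_prod_type]
  refine Finset.sum_congr rfl fun p _ => ?_
  simp only [h1, Finset.mul_sum]
  conv_rhs => rw [Finset.sum_comm]
  refine Finset.sum_congr rfl fun z _ => ?_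
  rw [← Equiv.sum_comp (splitEquiv h).symm fun b => extendMatrix h T ((splitEquiv h).symm (p, z)) b *
    tensor σ ρ b ((splitEquiv h).symm (p, z)), Fintype.sum_prod_type]
  refine Finset.sum_congr rfl fun q _ => ?_
  simp [extendMatrix_apply]

/-! ### Extension of elementary matrices -/

theorem getD_ofFn {α : Type*} {d : ℕ} (f : Fin d → α) (i : Fin d) (e : α) :
    (List.ofFn f).getD i e = f i := by
  rw [List.getD_eq_getElem _ _ (by simp), List.getElem_ofFn]

/-- The extension of an elementary matrix by the identity, divided by `N`. -/
def extendEntries (N : ℕ)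
    (E : Fin (2 ^ (n - m) * 2 ^ (n - m)) → Fin (2 ^ (n - m) * 2 ^ (n - m)) → ℚ × ℚ)
    (a b : Fin (2 ^ n * 2 ^ n)) : ℚ × ℚ :=
  if (splitEquiv h a).2 = (splitEquiv h b).2 then
    ((E (splitEquiv h a).1 (splitEquiv h b).1).1 / N, (E (splitEquiv h a).1 (splitEquiv h b).1).2 / N)
  else (0, 0)

theorem toMat_extendEntries (N : ℕ)
    (E : Fin (2 ^ (n - m) * 2 ^ (n - m)) → Fin (2 ^ (n - m) * 2 ^ (n - m)) → ℚ × ℚ) :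
    toMat (extendEntries h N E) = (N : ℝ)⁻¹ • extendMatrix h (toMat E) := by
  ext a b
  rw [Matrix.smul_apply, extendMatrix_apply, toMat, Matrix.of_apply, extendEntries]
  split_ifs
  · simp [toC_eq, toMat]
    ring
  · simp [toC_eq]

/-- The part of the index `a` that belongs to the first qubits of both systems. -/
def headIndex (m n a : ℕ) : ℕ := a % 2 ^ n / 2 ^ m + 2 ^ (n - m) * (a / 2 ^ n / 2 ^ m)

/-- The parts of the index `a` that belong to the last `m` qubits of both systems. -/
def tailIndex (m n a : ℕ) : ℕ × ℕ := (a / 2 ^ n % 2 ^ m, a % 2 ^ n % 2 ^ m)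

theorem splitEquiv_fst (a : Fin (2 ^ n * 2 ^ n)) :
    ((splitEquiv h a).1 : ℕ) = headIndex m n a := rfl

theorem splitEquiv_snd (a : Fin (2 ^ n * 2 ^ n)) :
    (((splitEquiv h a).2.1 : ℕ), ((splitEquiv h a).2.2 : ℕ)) = tailIndex m n a := rfl

/-- `extendEntries` for a matrix given as the list of its rows. -/
def extendRows (N m n : ℕ) (E : List (List (ℚ × ℚ))) : List (List (ℚ × ℚ)) :=
  (List.range (2 ^ n * 2 ^ n)).map fun a => (List.range (2 ^ n * 2 ^ n)).map fun b =>
    if tailIndex m n a = tailIndex m n b then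
      ((((E.getD (headIndex m n a) []).getD (headIndex m n b) (0, 0)).1 / N,
        ((E.getD (headIndex m n a) []).getD (headIndex m n b) (0, 0)).2 / N))
    else (0, 0)

theorem extendRows_ofFn (N : ℕ)
    (E : Fin (2 ^ (n - m) * 2 ^ (n - m)) → Fin (2 ^ (n - m) * 2 ^ (n - m)) → ℚ × ℚ) :
    extendRows N m n (List.ofFn fun i => List.ofFn (E i)) =
      List.ofFn fun i => List.ofFn (extendEntries h N E i) := by
  apply List.ext_getElem
  · simp [extendRows]
  intro a h1 h2
  simp only [List.length_ofFn] at h2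
  simp only [extendRows, List.getElem_map, List.getElem_range, List.getElem_ofFn]
  apply List.ext_getElem
  · simp
  intro b h3 h4
  simp only [List.length_ofFn] at h4
  simp only [List.getElem_map, List.getElem_range, List.getElem_ofFn, extendEntries]
  have ha := splitEquiv_fst h ⟨a, h2⟩
  have hb := splitEquiv_fst h ⟨b, h4⟩
  simp only at ha hb
  rw [← ha, ← hb]
  have hE : (((List.ofFn fun i => List.ofFn (E i)).getD ((splitEquiv h ⟨a, h2⟩).1 : ℕ) []).getD
      ((splitEquiv h ⟨b, h4⟩).1 : ℕ) (0, 0)) =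
      E (splitEquiv h ⟨a, h2⟩).1 (splitEquiv h ⟨b, h4⟩).1 := by
    rw [getD_ofFn, getD_ofFn]
  rw [hE]
  have hiff : tailIndex m n a = tailIndex m n b ↔
      (splitEquiv h ⟨a, h2⟩).2 = (splitEquiv h ⟨b, h4⟩).2 := by
    rw [← splitEquiv_snd h ⟨a, h2⟩, ← splitEquiv_snd h ⟨b, h4⟩]
    simp [Prod.ext_iff, Fin.ext_iff]
  simp only [hiff]

end

/-! ### Computability of the extension -/

theorem primrec_headIndex {α : Type*} [Primcodable α] {m n a : α → ℕ} (hm : Primrec m)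
    (hn : Primrec n) (ha : Primrec a) : Primrec fun x => headIndex (m x) (n x) (a x) :=
  Primrec.nat_add.comp
    (Primrec.nat_div.comp (Primrec.nat_mod.comp ha (primrec_two_pow hn)) (primrec_two_pow hm))
    (Primrec.nat_mul.comp (primrec_two_pow (Primrec.nat_sub.comp hn hm))
      (Primrec.nat_div.comp (Primrec.nat_div.comp ha (primrec_two_pow hn)) (primrec_two_pow hm)))

theorem primrec_tailIndex {α : Type*} [Primcodable α] {m n a : α → ℕ} (hm : Primrec m)
    (hn : Primrec n) (ha : Primrec a) : Primrec fun x => tailIndex (m x) (n x) (a x) :=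
  Primrec.pair
    (Primrec.nat_mod.comp (Primrec.nat_div.comp ha (primrec_two_pow hn)) (primrec_two_pow hm))
    (Primrec.nat_mod.comp (Primrec.nat_mod.comp ha (primrec_two_pow hn)) (primrec_two_pow hm))

theorem primrec_extendRows (N : ℕ) {α : Type*} [Primcodable α] {m n : α → ℕ}
    {E : α → List (List (ℚ × ℚ))} (hm : Primrec m) (hn : Primrec n) (hE : Primrec E) :
    Primrec fun x => extendRows N (m x) (n x) (E x) := by
  have hr : Primrec fun x => List.range (2 ^ n x * 2 ^ n x) :=
    Primrec.list_range.comp (Primrec.nat_mul.comp (primrec_two_pow hn) (primrec_two_pow hn))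
  refine Primrec.list_map hr (Primrec.list_map (hr.comp Primrec.fst) ?_)
  have hx : Primrec fun y : (α × ℕ) × ℕ => y.1.1 := Primrec.fst.comp Primrec.fst
  have ha : Primrec fun y : (α × ℕ) × ℕ => y.1.2 := Primrec.snd.comp Primrec.fst
  have hb : Primrec fun y : (α × ℕ) × ℕ => y.2 := Primrec.snd
  have hc : Primrec fun y : (α × ℕ) × ℕ =>
      ((E y.1.1).getD (headIndex (m y.1.1) (n y.1.1) y.1.2) []).getD
        (headIndex (m y.1.1) (n y.1.1) y.2) (0, 0) :=
    (Primrec.list_getD (0, 0)).comp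
      ((Primrec.list_getD []).comp (hE.comp hx) (primrec_headIndex (hm.comp hx) (hn.comp hx) ha))
      (primrec_headIndex (hm.comp hx) (hn.comp hx) hb)
  exact Primrec.ite (Primrec.eq.comp (primrec_tailIndex (hm.comp hx) (hn.comp hx) ha)
    (primrec_tailIndex (hm.comp hx) (hn.comp hx) hb))
    (Primrec.pair (primrec_rat_div (Primrec.fst.comp hc) (Primrec.const (N : ℚ)))
      (primrec_rat_div (Primrec.snd.comp hc) (Primrec.const (N : ℚ)))) (Primrec.const (0, 0))

theorem computable_extendRows (N : ℕ) : Computable₂ fun x w : ℕ =>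
    rowsCode (extendRows N x.unpair.1 x.unpair.2 (rowsDecode w)) := by
  have hx : Primrec fun a : ℕ × ℕ => a.1.unpair := Primrec.unpair.comp Primrec.fst
  exact (primrec_rowsCode.comp (primrec_extendRows N (Primrec.fst.comp hx) (Primrec.snd.comp hx)
    (primrec_rowsDecode.comp Primrec.snd))).to_comp

theorem rowsCode_extendRows {m n : ℕ} (h : m ≤ n) (N : ℕ)
    (E : Fin (2 ^ (n - m) * 2 ^ (n - m)) → Fin (2 ^ (n - m) * 2 ^ (n - m)) → ℚ × ℚ) :
    rowsCode (extendRows N m n (rowsDecode (matCode E))) = matCode (extendEntries h N E) := by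
  rw [← rowsCode_ofFn, rowsDecode_rowsCode, extendRows_ofFn h, rowsCode_ofFn]

/-! ### Lower computable matrices -/

variable {U : Machine}

theorem Machine.LowerComputes.posSemidef {x d : ℕ} {q : List Bool} {M : Matrix (Fin d) (Fin d) ℂ}
    (hq : U.LowerComputes x q M) : M.PosSemidef := by
  obtain ⟨-, E, -, -, -, hE, -, hM⟩ := hq
  exact posSemidef_of_tendsto hE hM

/-- The printed codes determine the matrices, and the convention for a finite output determines the
rest of the sequence. Distinct matrices thus have disjoint sets of programs, so that their lower
probabilities add up to at most 1. -/
theorem Machine.LowerComputes.unique {x d : ℕ} {q : List Bool} {M M' : Matrix (Fin d) (Fin d) ℂ}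
    (hq : U.LowerComputes x q M) (hq' : U.LowerComputes x q M') : M = M' := by
  obtain ⟨-, E, ⟨w, hw⟩, hE, hs, -, -, hM⟩ := hq
  obtain ⟨-, E', -, hE', hs', -, -, hM'⟩ := hq'
  have : ∀ i, E i = E' i := by
    intro i
    induction i with
    | zero => exact matCode_injective ((hE 0 w hw).symm.trans (hE' 0 w hw))
    | succ i ih =>
      by_cases hp : ∃ w, U.Prints x q (i + 1) w
      · obtain ⟨w, hw⟩ := hp
        exact matCode_injective ((hE _ w hw).symm.trans (hE' _ w hw))
      · rw [hs i (not_exists.1 hp), hs' i (not_exists.1 hp), ih]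
  rw [funext this] at hM
  exact tendsto_nhds_unique hM hM'

/-- Each printed code is translated separately; the auxiliary input (m, n) supplies the dimensions.
Extension and division by `N` preserve positivity, order and limits. -/
theorem Machine.IsUniversal.lowerComputes_extendMatrix (hU : U.IsUniversal) (N : ℕ) :
    ∃ r : List Bool, ∀ (m n : ℕ) (h : m ≤ n) (q : List Bool)
      (T : Matrix (Fin (2 ^ (n - m) * 2 ^ (n - m))) (Fin (2 ^ (n - m) * 2 ^ (n - m))) ℂ),
      U.LowerComputes (Nat.pair m n) q T →
        U.LowerComputes (Nat.pair m n) (r ++ q) ((N : ℝ)⁻¹ • extendMatrix h T) := by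
  obtain ⟨r, hr⟩ := hU (U.postprocess id _ Computable.id (computable_extendRows N))
  refine ⟨r, fun m n h q T hq => ?_⟩
  obtain ⟨hst, E, ⟨w, hw⟩, hE, hs, hE0, hE1, hT⟩ := hq
  obtain ⟨-, hprints, hstarves⟩ := hr (Nat.pair m n) q
  simp only [postprocess_prints, id] at hprints
  refine ⟨?_, fun i => extendEntries h N (E i), ⟨_, (hprints 0 _).2 ⟨w, hw, rfl⟩⟩, ?_, ?_, ?_, ?_,
    ?_⟩
  · rw [hstarves, postprocess_starves]
    exact hst
  · intro i w' hw'
    obtain ⟨v, hv, rfl⟩ := (hprints i w').1 hw'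
    rw [hE i v hv, Nat.unpair_pair]
    exact rowsCode_extendRows h N (E i)
  · intro i hi
    simp only
    rw [hs i fun v hv => hi _ ((hprints _ _).2 ⟨v, hv, rfl⟩)]
  · intro i
    rw [toMat_extendEntries]
    exact (posSemidef_extendMatrix h (hE0 i)).smul (by positivity)
  · intro i
    rw [toMat_extendEntries, toMat_extendEntries, ← smul_sub, ← extendMatrix_sub]
    exact (posSemidef_extendMatrix h (hE1 i)).smul (by positivity)
  · simp only [toMat_extendEntries]
    exact (((continuous_extendMatrix h).tendsto T).comp hT).const_smul _

theorem tsum_lowerProb_le_one (x k d : ℕ) (s : Set (Matrix (Fin d) (Fin d) ℂ)) :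
    ∑' T : s, lowerProb U x k T.1 ≤ 1 := by
  simp only [lowerProb]
  rw [← ENNReal.tsum_sigma' (f := fun a : (T : s) × {q : List Bool // U.LowerComputes x q T.1} =>
    U.prob (Nat.pair k x) (Encodable.encode a.2.1))]
  refine le_trans ?_ (Machine.tsum_prob_le_one (U := U) (Nat.pair k x))
  refine ENNReal.tsum_comp_le_tsum_of_injective (f := fun a : (T : s) ×
    {q : List Bool // U.LowerComputes x q T.1} => Encodable.encode a.2.1) ?_ _
  rintro ⟨⟨T, hT⟩, q, hq⟩ ⟨⟨T', hT'⟩, q', hq'⟩ he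
  have hqq : q = q' := Encodable.encode_injective he
  subst hqq
  cases hq.unique hq'
  rfl

theorem lowerProb_ne_top (x k : ℕ) {d : ℕ} (T : Matrix (Fin d) (Fin d) ℂ) :
    lowerProb U x k T ≠ ∞ := by
  have h := tsum_lowerProb_le_one (U := U) x k d {T}
  have h1 := (ENNReal.le_tsum (f := fun S : ({T} : Set (Matrix (Fin d) (Fin d) ℂ)) =>
    lowerProb U x k S.1) ⟨T, rfl⟩).trans h
  exact (h1.trans_lt ENNReal.one_lt_top).ne

/-- Given n, m and n, a machine can compute the condition n - m, simulate the generation of a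
program `q` under it, and put the fixed prefix `r` in front of `q`. -/
theorem Machine.IsUniversal.lowerProb_extendMatrix (hU : U.IsUniversal) (N : ℕ) :
    ∃ K : ℕ, ∀ (m n : ℕ) (h : m ≤ n)
      (T : Matrix (Fin (2 ^ (n - m) * 2 ^ (n - m))) (Fin (2 ^ (n - m) * 2 ^ (n - m))) ℂ),
      2⁻¹ ^ K * lowerProb U (Nat.pair m n) (n - m) T ≤
        lowerProb U (Nat.pair m n) n ((N : ℝ)⁻¹ • extendMatrix h T) := by
  obtain ⟨r, hr⟩ := hU.lowerComputes_extendMatrix N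
  have hh : Computable fun y : ℕ =>
      Nat.pair (y.unpair.1 - y.unpair.2.unpair.1) y.unpair.2 := by
    have h1 : Primrec fun y : ℕ => y.unpair.2 := Primrec.snd.comp Primrec.unpair
    have h2 : Primrec fun y : ℕ => y.unpair.1 := Primrec.fst.comp Primrec.unpair
    exact (Primrec₂.natPair.comp (Primrec.nat_sub.comp h2 (h2.comp h1)) h1).to_comp
  have hg : Computable₂ fun _ w : ℕ =>
      Encodable.encode (r ++ (Encodable.decode (α := List Bool) w).getD []) := by
    have h1 : Primrec fun a : ℕ × ℕ => (Encodable.decode (α := List Bool) a.2).getD [] :=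
      Primrec.option_getD.comp (Primrec.decode.comp Primrec.snd) (Primrec.const [])
    exact (Primrec.encode.comp (Primrec.list_append.comp (Primrec.const r) h1)).to_comp
  obtain ⟨K, hK⟩ := hU.prob_map_le hh hg
  refine ⟨K, fun m n h T => ?_⟩
  rw [lowerProb, lowerProb, ← ENNReal.tsum_mul_left]
  let f : {q : List Bool // U.LowerComputes (Nat.pair m n) q T} → {q : List Bool //
      U.LowerComputes (Nat.pair m n) q ((N : ℝ)⁻¹ • extendMatrix h T)} :=
    fun q => ⟨r ++ q.1, hr m n h q.1 T q.2⟩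
  have hf : Function.Injective f := fun p q he => by
    simpa [f, Subtype.ext_iff] using he
  refine le_trans (ENNReal.tsum_le_tsum fun q => ?_)
    (ENNReal.tsum_comp_le_tsum_of_injective hf _)
  have := hK (Nat.pair n (Nat.pair m n)) (Encodable.encode q.1)
  simp only [Nat.unpair_pair, Encodable.encodek, Option.getD_some] at this
  exact this

variable {U : Machine}

/-! ### The information matrix -/

/-- From μ ≥ c · 1 follows c² Tr T ≤ Tr T(μ ⊗ μ) ≤ 1. -/
theorem Machine.IsUniversal.exists_trace_le (hU : U.IsUniversal) (x k : ℕ) :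
    ∃ K : ℝ, ∀ T ∈ productTests U x (universalMatrix U x k) (universalMatrix U x k),
      (Matrix.trace T).re ≤ K := by
  obtain ⟨c, hc, hle⟩ := hU.exists_smul_one_le x k
  refine ⟨(c ^ 2)⁻¹, fun T hT => ?_⟩
  obtain ⟨⟨q, hq⟩, -, h1⟩ := hT
  have h2 := reTrace_mono hq.posSemidef
    (posSemidef_tensor_sub (Matrix.PosSemidef.one.smul hc.le) (posSemidef_universalMatrix x k) hle)
  rw [tensor_smul, tensor_one, reTrace_smul, reTrace_apply, reTrace_apply, Matrix.mul_one] at h2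
  rw [← one_div, le_div_iff₀ (by positivity)]
  linarith

/-- Needed because the sum of a family that is not summable is 0 by convention. The weights are
summable and the bounded traces bound all entries. -/
theorem Machine.IsUniversal.summable_infoMatrix (hU : U.IsUniversal) (x k : ℕ) :
    Summable fun T : productTests U x (universalMatrix U x k) (universalMatrix U x k) =>
      (lowerProb U x k T.1).toReal • T.1 := by
  obtain ⟨K, hK⟩ := hU.exists_trace_le x k
  refine summable_toReal_smul (K := K)
    ((tsum_lowerProb_le_one x k _ _).trans_lt ENNReal.one_lt_top).ne fun T i j => ?_
  obtain ⟨q, hq⟩ := T.2.1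
  exact (norm_entry_le_trace hq.posSemidef i j).trans (hK T.1 T.2)

theorem Machine.IsUniversal.ofReal_reTrace_infoMatrix (hU : U.IsUniversal) (x k : ℕ)
    {S : Matrix (Fin (2 ^ k * 2 ^ k)) (Fin (2 ^ k * 2 ^ k)) ℂ} (hS : S.PosSemidef) :
    ENNReal.ofReal (reTrace S (infoMatrix U x k)) =
      ∑' T : productTests U x (universalMatrix U x k) (universalMatrix U x k),
        lowerProb U x k T.1 * ENNReal.ofReal (reTrace S T.1) := by
  refine ofReal_functional_tsum (hU.summable_infoMatrix x k) (fun T => lowerProb_ne_top _ _ _) _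
    fun T => ?_
  obtain ⟨q, hq⟩ := T.2.1
  exact reTrace_nonneg hq.posSemidef hS

/-- The extension of a test for the universal matrix over `n - m` qubits is, after division by a
constant, a test for the universal matrix over `n` qubits. -/
theorem Machine.IsUniversal.extendMatrix_mem_productTests (hU : U.IsUniversal) :
    ∃ N : ℕ, 0 < N ∧ ∀ (m n : ℕ) (h : m ≤ n),
      ∀ T ∈ productTests U (Nat.pair m n) (universalMatrix U (Nat.pair m n) (n - m))
        (universalMatrix U (Nat.pair m n) (n - m)),
      (N : ℝ)⁻¹ • extendMatrix h T ∈ productTests U (Nat.pair m n)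
        (universalMatrix U (Nat.pair m n) n) (universalMatrix U (Nat.pair m n) n) := by
  obtain ⟨K, hK⟩ := hU.partialTrace_universalMatrix_le
  -- One factor `2 ^ K` from the domination for each of the two systems.
  refine ⟨(2 ^ K) ^ 2, by positivity, fun m n h T hT => ?_⟩
  obtain ⟨r, hr⟩ := hU.lowerComputes_extendMatrix ((2 ^ K) ^ 2)
  obtain ⟨⟨q, hq⟩, ⟨A, B, rfl⟩, h1⟩ := hT
  refine ⟨⟨r ++ q, hr m n h q _ hq⟩, ?_, ?_⟩
  · obtain ⟨A', B', he⟩ := extendMatrix_tensor h A B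
    refine ⟨((((2 ^ K) ^ 2 : ℕ) : ℝ)⁻¹) • A', B', ?_⟩
    rw [he]
    ext a b
    simp only [Matrix.smul_apply, tensor_apply, smul_mul_assoc]
  · have h2 := reTrace_mono hq.posSemidef (posSemidef_tensor_sub
      (posSemidef_partialTrace h (posSemidef_universalMatrix (U := U) (Nat.pair m n) n))
      ((posSemidef_universalMatrix (U := U) (Nat.pair m n) (n - m)).smul
        (by positivity : (0 : ℝ) ≤ 2 ^ K)) (hK m n h))
    rw [tensor_smul, reTrace_smul, reTrace_apply, reTrace_apply, ← trace_extendMatrix_mul] at h2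
    rw [Matrix.smul_mul, Matrix.trace_smul, Complex.smul_re, smul_eq_mul,
      inv_mul_le_iff₀ (by positivity)]
    push_cast
    refine h2.trans ?_
    gcongr

theorem le_two_pow_mul {K : ℕ} {a b : ℝ≥0∞} (h : 2⁻¹ ^ K * a ≤ b) : a ≤ 2 ^ K * b := by
  calc a = 2 ^ K * (2⁻¹ ^ K * a) := by
        rw [← mul_assoc, ← mul_pow, ENNReal.mul_inv_cancel (by simp) (by simp), one_pow, one_mul]
    _ ≤ _ := mul_le_mul_right h _

/-- `T` is sent to its extension divided by `N`. The factor `N` compensates for the division and `2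
^ K` for the loss of weight; the map being injective, the image terms form a part of the sum for n
qubits. -/
theorem Machine.IsUniversal.reTrace_infoMatrix_partialTrace_le (hU : U.IsUniversal) :
    ∃ C : ℝ, 0 < C ∧ ∀ (m n : ℕ) (h : m ≤ n) (σ ρ : Matrix (Fin (2 ^ n)) (Fin (2 ^ n)) ℂ),
      σ.PosSemidef → ρ.PosSemidef →
      reTrace (tensor (partialTrace h σ) (partialTrace h ρ))
          (infoMatrix U (Nat.pair m n) (n - m)) ≤
        C * reTrace (tensor σ ρ) (infoMatrix U (Nat.pair m n) n) := by
  obtain ⟨N, hN0, hN⟩ := hU.extendMatrix_mem_productTests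
  obtain ⟨K, hK⟩ := hU.lowerProb_extendMatrix N
  refine ⟨N * 2 ^ K, by positivity, fun m n h σ ρ hσ hρ => ?_⟩
  have hS := posSemidef_tensor hσ hρ
  have hS' := posSemidef_tensor (posSemidef_partialTrace h hσ) (posSemidef_partialTrace h hρ)
  have hpos : 0 ≤ reTrace (tensor σ ρ) (infoMatrix U (Nat.pair m n) n) :=
    reTrace_nonneg (posSemidef_tsum (hU.summable_infoMatrix _ _) fun T => by
      obtain ⟨q, hq⟩ := T.2.1
      exact hq.posSemidef) hS
  rw [← ENNReal.ofReal_le_ofReal_iff (by positivity), ENNReal.ofReal_mul (by positivity),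
    hU.ofReal_reTrace_infoMatrix _ _ hS, hU.ofReal_reTrace_infoMatrix _ _ hS']
  let f : productTests U (Nat.pair m n) (universalMatrix U (Nat.pair m n) (n - m))
        (universalMatrix U (Nat.pair m n) (n - m)) →
      productTests U (Nat.pair m n)
        (universalMatrix U (Nat.pair m n) n) (universalMatrix U (Nat.pair m n) n) :=
    fun T => ⟨_, hN m n h T.1 T.2⟩
  have hNr : (N : ℝ) ≠ 0 := by positivity
  have hf : Function.Injective f := fun T T' he => by
    have h1 : (N : ℝ)⁻¹ • extendMatrix h T.1 = (N : ℝ)⁻¹ • extendMatrix h T'.1 :=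
      congrArg Subtype.val he
    exact Subtype.ext (extendMatrix_injective h (smul_right_injective _ (inv_ne_zero hNr) h1))
  rw [← ENNReal.tsum_mul_left]
  refine le_trans (ENNReal.tsum_le_tsum fun T => ?_)
    (ENNReal.tsum_comp_le_tsum_of_injective hf _)
  have h1 : reTrace (tensor (partialTrace h σ) (partialTrace h ρ)) T.1 =
      N * reTrace (tensor σ ρ) (f T).1 := by
    rw [show (f T).1 = (N : ℝ)⁻¹ • extendMatrix h T.1 from rfl, map_smul, smul_eq_mul,
      ← mul_assoc, mul_inv_cancel₀ hNr, one_mul, reTrace_apply, reTrace_apply,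
      trace_extendMatrix_mul]
  have h2 : lowerProb U (Nat.pair m n) (n - m) T.1 ≤
      2 ^ K * lowerProb U (Nat.pair m n) n (f T).1 := by
    exact le_two_pow_mul (hK m n h T.1)
  rw [h1, ENNReal.ofReal_mul (by positivity), ENNReal.ofReal_mul (by positivity),
    ENNReal.ofReal_pow (by positivity), ENNReal.ofReal_ofNat]
  calc _ ≤ 2 ^ K * lowerProb U (Nat.pair m n) n (f T).1 *
        (ENNReal.ofReal N * ENNReal.ofReal (reTrace (tensor σ ρ) (f T).1)) := by gcongr
    _ = _ := by ring

theorem log2_le_log2_add {C a b : ℝ} (hC : 0 < C) (h : a ≤ C * b) :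
    log2 a ≤ log2 b + (Real.logb 2 C : ℝ) := by
  by_cases ha : 0 < a
  · have hb : 0 < b := pos_of_mul_pos_right (ha.trans_le h) hC.le
    rw [log2, log2, if_pos ha, if_pos hb, ← EReal.coe_add, EReal.coe_le_coe_iff, add_comm,
      ← Real.logb_mul hC.ne' hb.ne']
    exact Real.logb_le_logb_of_le (by norm_num) ha h
  -- Here the left side is -∞, whatever the sign of `b`.
  · rw [log2, if_neg ha]
    exact bot_le

end QuantumInfo

theorem theorem10 (U : QuantumInfo.Machine) (hU : U.IsUniversal) :
    ∃ c : ℝ, ∀ (m n : ℕ) (hmn : m < n) (σ ρ : Matrix (Fin (2 ^ n)) (Fin (2 ^ n)) ℂ),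
      QuantumInfo.IsSemiDensity σ → QuantumInfo.IsSemiDensity ρ →
        QuantumInfo.info U (Nat.pair m n) (n - m)
            (QuantumInfo.partialTrace hmn.le σ) (QuantumInfo.partialTrace hmn.le ρ) ≤
          QuantumInfo.info U (Nat.pair m n) n σ ρ + (c : EReal) := by
  obtain ⟨C, hC, h⟩ := hU.reTrace_infoMatrix_partialTrace_le
  exact ⟨Real.logb 2 C, fun m n hmn σ ρ hσ hρ =>
    QuantumInfo.log2_le_log2_add hC (h m n hmn.le σ ρ hσ.1 hρ.1)⟩
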